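/- Let $Q=\begin{pmatrix}q_1&q_2\\ q_3&q_4\end{pmatrix}$ with complex-valued $q_j\in L_1[0,\pi]$, let $B=\begin{pmatrix}0&1\\-1&0\end{pmatrix}$, and let $\mathcal U=(u_{kj})$ be a complex $2\times4$ matrix, whose minor on the columns $s,j$ (in this order) is denoted $J_{sj}$. In the space $\mathbb H=L_2[0,\pi]\oplus L_2[0,\pi]$ let $L_{Q,U}$ be the Dirac operator acting by $l_Q(\mathbf y)=-B\mathbf y'+Q\mathbf y$ on the domain of all absolutely continuous $\mathbf y=(y_1,y_2)^t$ on $[0,\pi]$ such that $l_Q(\mathbf y)\in\mathbb H$ and $\mathcal U\,(y_1(0),y_2(0),y_1(\pi),y_2(\pi))^t=0$. Assume that $L_{0,U}$ is strongly regular, i.e. that the boundary conditions are regular, meaning that both numbers $J_{14}+J_{32}\pm i(J_{42}-J_{13})$ are nonzero, and that the quadratic equation $$[J_{14}-J_{23}-i(J_{13}+J_{24})]z^2+2[J_{12}+J_{34}]z+[J_{14}-J_{23}+i(J_{13}+J_{24})]=0$$ has nonzero discriminant. Theorem 4.1. There are $\alpha>1$ and a constant $C$, independent of $\lambda$, such that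 for all $\lambda\in\mathbb C$ with $|\operatorname{Im}\lambda|>\alpha$ the resolvent $R(\lambda)=(L_{Q,U}-\lambda)^{-1}$ exists as a bounded operator on $\mathbb H$ and satisfies $$\|R(\lambda)\|\le C\,|\operatorname{Im}\lambda|^{-1}.$$ Moreover, the spectrum of $L_{Q,U}$ is discrete: $L_{Q,U}$ has a compact resolvent, and its spectrum has no finite accumulation points and consists of eigenvalues of finite algebraic multiplicity (finite-dimensional root subspaces $\bigcup_n\ker(L_{Q,U}-\lambda)^n$). -/

import Mathlib

open MeasureTheory Set

noncomputable section

namespace Dirac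

/-! ### The resolvent and the spectrum of an unbounded operator -/

section Unbounded

variable {H : Type*} [NormedAddCommGroup H] [NormedSpace ℂ H]

/-- `R` is the resolvent `(T - z)⁻¹`: a bounded operator, defined on the whole space, which is a
two-sided inverse of `T - z : D(T) → H`. -/
def IsResolventAt (T : H →ₗ.[ℂ] H) (z : ℂ) (R : H →L[ℂ] H) : Prop :=
  (∀ f : H, ∃ h : R f ∈ T.domain, T ⟨R f, h⟩ - z • R f = f) ∧
    ∀ y : T.domain, R (T y - z • (y : H)) = y

/-- The resolvent set of an unbounded operator. -/
def resolventSet (T : H →ₗ.[ℂ] H) : Set ℂ := {z | ∃ R : H →L[ℂ] H, IsResolventAt T z R}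

/-- The spectrum of an unbounded operator. -/
def spectrum (T : H →ₗ.[ℂ] H) : Set ℂ := (resolventSet T)ᶜ

/-- `kerPow T z n = ker (T - z) ^ n`, with the natural domain of the power: `y ∈ ker (T - z) ^ (n + 1)`
iff `y ∈ D(T)` and `(T - z) y ∈ ker (T - z) ^ n`. -/
def kerPow (T : H →ₗ.[ℂ] H) (z : ℂ) : ℕ → Submodule ℂ H
  | 0 => ⊥
  | n + 1 => ((kerPow T z n).comap (T.toFun - z • T.domain.subtype)).map T.domain.subtype

/-- The root subspace (eigenvectors and associated vectors) of `T` at `z`, the union of the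
increasing sequence `ker (T - z) ^ n`. Its dimension is the algebraic multiplicity. -/
def rootSubspace (T : H →ₗ.[ℂ] H) (z : ℂ) : Submodule ℂ H := ⨆ n, kerPow T z n

/-- `T` has discrete spectrum: some resolvent of `T` exists and is compact, the spectrum has no
finite accumulation point, and each of its points is an eigenvalue of finite algebraic
multiplicity. -/
structure HasDiscreteSpectrum (T : H →ₗ.[ℂ] H) : Prop where
  compact_resolvent : ∃ (z : ℂ) (R : H →L[ℂ] H), IsResolventAt T z R ∧ IsCompactOperator R
  finite_inter_closedBall : ∀ r : ℝ, (spectrum T ∩ Metric.closedBall 0 r).Finite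
  isEigenvalue : ∀ z ∈ spectrum T, ∃ y : T.domain, (y : H) ≠ 0 ∧ T y = z • (y : H)
  finite_multiplicity : ∀ z ∈ spectrum T, FiniteDimensional ℂ (rootSubspace T z)

end Unbounded

/-! ### Boundary conditions -/

/-- The linear form `U(y) = A y(0) + D y(π)` given by the extended `2 × 4` matrix `U = (A | D)`. -/
def boundaryForm (U : Matrix (Fin 2) (Fin 4) ℂ) (y : ℝ → EuclideanSpace ℂ (Fin 2)) : Fin 2 → ℂ :=
  U.mulVec ![y 0 0, y 0 1, y Real.pi 0, y Real.pi 1]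

/-- The minor on the columns `a`, `b` (in this order) of the matrix `U`; the columns are
numbered from `1` to `4`. -/
def J (U : Matrix (Fin 2) (Fin 4) ℂ) (a b : ℕ) : ℂ :=
  (U.submatrix id ![Fin.ofNat 4 (a - 1), Fin.ofNat 4 (b - 1)]).det

/-- Regular boundary conditions. -/
def IsRegular (U : Matrix (Fin 2) (Fin 4) ℂ) : Prop :=
  J U 1 4 + J U 3 2 + Complex.I * (J U 4 2 - J U 1 3) ≠ 0 ∧
    J U 1 4 + J U 3 2 - Complex.I * (J U 4 2 - J U 1 3) ≠ 0

/-- Strong regularity of the operator with zero potential and boundary conditions `U`: the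
conditions are regular and the quadratic equation for `z = exp (i π λ)`, whose roots give the
eigenvalues, has nonzero discriminant. -/
def IsStronglyRegular (U : Matrix (Fin 2) (Fin 4) ℂ) : Prop :=
  IsRegular U ∧
    discrim (J U 1 4 - J U 2 3 - Complex.I * (J U 1 3 + J U 2 4))
      (2 * (J U 1 2 + J U 3 4))
      (J U 1 4 - J U 2 3 + Complex.I * (J U 1 3 + J U 2 4)) ≠ 0

/-! ### The Dirac operator -/

/-- The Hilbert space `L₂[0,π] ⊕ L₂[0,π]`, as the space of `ℂ²`-valued `L₂` functions, `ℂ²` with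
its Euclidean norm. -/
abbrev Space : Type :=
  Lp (EuclideanSpace ℂ (Fin 2)) 2 (volume.restrict (Icc (0 : ℝ) Real.pi))

/-- The matrix `B` of the Dirac system. -/
def matB : Matrix (Fin 2) (Fin 2) ℂ := !![0, 1; -1, 0]

/-- The differential expression `l_Q(y) = -B y' + Q y`. -/
def diffExpr (Q : ℝ → Matrix (Fin 2) (Fin 2) ℂ) (y : ℝ → EuclideanSpace ℂ (Fin 2)) (x : ℝ) :
    EuclideanSpace ℂ (Fin 2) :=
  -(matB.toEuclideanLin (deriv y x)) + (Q x).toEuclideanLin (y x)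

/-- `y` represents a point `(f, g)` of the graph of the Dirac operator: `y` is absolutely continuous on
`[0,π]` and satisfies the boundary conditions, `f` is the class of `y`, and `g`, an element of
`L₂`, is the class of `l_Q(y)`. The clause on differentiability holds a.e. for absolutely
continuous functions; it makes explicit that `deriv` is the derivative. -/
structure Represents (Q : ℝ → Matrix (Fin 2) (Fin 2) ℂ) (U : Matrix (Fin 2) (Fin 4) ℂ)
    (y : ℝ → EuclideanSpace ℂ (Fin 2)) (f g : Space) : Prop where
  ac : AbsolutelyContinuousOnInterval y 0 Real.pi
  bc : boundaryForm U y = 0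
  diff : ∀ᵐ x ∂volume.restrict (Icc (0 : ℝ) Real.pi), DifferentiableAt ℝ y x
  fst : f =ᵐ[volume.restrict (Icc (0 : ℝ) Real.pi)] y
  snd : g =ᵐ[volume.restrict (Icc (0 : ℝ) Real.pi)] diffExpr Q y

variable {Q : ℝ → Matrix (Fin 2) (Fin 2) ℂ} {U : Matrix (Fin 2) (Fin 4) ℂ}

theorem Represents.add {y₁ y₂ : ℝ → EuclideanSpace ℂ (Fin 2)} {f₁ g₁ f₂ g₂ : Space}
    (h₁ : Represents Q U y₁ f₁ g₁) (h₂ : Represents Q U y₂ f₂ g₂) :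
    Represents Q U (y₁ + y₂) (f₁ + f₂) (g₁ + g₂) where
  ac := h₁.ac.add h₂.ac
  bc := by
    have e : boundaryForm U (y₁ + y₂) = boundaryForm U y₁ + boundaryForm U y₂ := by
      unfold boundaryForm
      rw [← Matrix.mulVec_add]
      congr 1
      ext i
      fin_cases i <;> simp
    rw [e, h₁.bc, h₂.bc, add_zero]
  diff := by
    filter_upwards [h₁.diff, h₂.diff] with x a b using a.add b
  fst := by
    filter_upwards [Lp.coeFn_add f₁ f₂, h₁.fst, h₂.fst] with x e a b
    rw [e, Pi.add_apply, a, b, Pi.add_apply]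
  snd := by
    filter_upwards [Lp.coeFn_add g₁ g₂, h₁.snd, h₂.snd, h₁.diff, h₂.diff] with x e a b c d
    rw [e, Pi.add_apply, a, b]
    simp only [diffExpr, deriv_add c d, Pi.add_apply, map_add]
    abel

theorem Represents.smul (c : ℂ) {y : ℝ → EuclideanSpace ℂ (Fin 2)} {f g : Space}
    (h : Represents Q U y f g) : Represents Q U (c • y) (c • f) (c • g) where
  ac := h.ac.const_smul c
  bc := by
    have e : boundaryForm U (c • y) = c • boundaryForm U y := by
      unfold boundaryForm
      rw [← Matrix.mulVec_smul]
      congr 1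
      ext i
      fin_cases i <;> simp
    rw [e, h.bc, smul_zero]
  diff := by
    filter_upwards [h.diff] with x a using a.const_smul c
  fst := by
    filter_upwards [Lp.coeFn_smul c f, h.fst] with x e a
    rw [e, Pi.smul_apply, a, Pi.smul_apply]
  snd := by
    filter_upwards [Lp.coeFn_smul c g, h.snd, h.diff] with x e a d
    rw [e, Pi.smul_apply, a]
    simp only [diffExpr, deriv_const_smul c d, Pi.smul_apply, map_smul, smul_add, smul_neg]

theorem represents_zero : Represents Q U 0 0 0 where
  ac := by
    have := (LipschitzWith.const (α := ℝ) (0 : EuclideanSpace ℂ (Fin 2))).lipschitzOnWith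
      (s := uIcc 0 Real.pi)
    exact this.absolutelyContinuousOnInterval
  bc := by
    have e : (![(0 : ℂ), 0, 0, 0]) = 0 := by ext i; fin_cases i <;> rfl
    simp [boundaryForm, e]
  diff := Filter.Eventually.of_forall fun x => differentiableAt_const _
  fst := Lp.coeFn_zero _ _ _
  snd := by
    filter_upwards [Lp.coeFn_zero (EuclideanSpace ℂ (Fin 2)) 2
      (volume.restrict (Icc (0 : ℝ) Real.pi))] with x e
    rw [e]
    simp [diffExpr]

/-- The operator is single-valued. -/
theorem Represents.eq_zero {y : ℝ → EuclideanSpace ℂ (Fin 2)} {g : Space}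
    (h : Represents Q U y 0 g) : g = 0 := by
  have h0 : y =ᵐ[volume.restrict (Icc (0 : ℝ) Real.pi)] 0 :=
    h.fst.symm.trans (Lp.coeFn_zero _ _ _)
  have hc : ContinuousOn y (Icc 0 Real.pi) := by
    have := h.ac.continuousOn
    rwa [uIcc_of_le Real.pi_pos.le] at this
  have hy : EqOn y 0 (Icc 0 Real.pi) :=
    Measure.eqOn_Icc_of_ae_eq volume Real.pi_pos.ne h0 hc continuousOn_const
  apply Lp.ext
  have hI : ∀ᵐ x ∂volume.restrict (Icc (0 : ℝ) Real.pi), x ∈ Ioo 0 Real.pi := by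
    rw [← Measure.restrict_congr_set Ioo_ae_eq_Icc]
    exact ae_restrict_mem measurableSet_Ioo
  filter_upwards [h.snd, hI, Lp.coeFn_zero (EuclideanSpace ℂ (Fin 2)) 2
      (volume.restrict (Icc (0 : ℝ) Real.pi))] with x e hx e0
  have hd : deriv y x = 0 := by
    have : y =ᶠ[nhds x] fun _ => 0 := by
      filter_upwards [Icc_mem_nhds hx.1 hx.2] with t ht using hy ht
    rw [this.deriv_eq, deriv_const]
  rw [e, e0]
  simp [diffExpr, hd, hy (Ioo_subset_Icc_self hx)]

variable (Q U)

/-- The graph of the Dirac operator with potential `Q` and boundary conditions `U(y) = 0`. -/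
def graph : Submodule ℂ (Space × Space) where
  carrier := {p | ∃ y, Represents Q U y p.1 p.2}
  add_mem' := by
    rintro p q ⟨y, hy⟩ ⟨z, hz⟩
    exact ⟨y + z, hy.add hz⟩
  zero_mem' := ⟨0, represents_zero⟩
  smul_mem' := by
    rintro c p ⟨y, hy⟩
    exact ⟨c • y, hy.smul c⟩

/-- The Dirac operator `L_{Q,U}`: it acts by `l_Q(y) = -B y' + Q y` on the absolutely continuous
functions `y` on `[0,π]` with `l_Q(y) ∈ L₂` and `U(y) = 0`. -/
def operator : Space →ₗ.[ℂ] Space := (graph Q U).toLinearPMap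

theorem operator_graph : (operator Q U).graph = graph Q U := by
  apply Submodule.toLinearPMap_graph_eq
  rintro ⟨f, g⟩ ⟨y, hy⟩ h
  simp only at h hy ⊢
  subst h
  exact hy.eq_zero

end Dirac

end

/-! Put `τ = |Im z|`. The substitution `w₁ = y₁ - j y₂`, `w₂ = y₁ + j y₂` with `j² = -1`
diagonalises `-B y' = z y + h` into `w₁' = -s w₁ + g₁`, `w₂' = s w₂ + g₂`, where `s = -j z`; the
sign of `j` is chosen by the half-plane so that `Re s = τ`. Integrating `w₁` forwards from `0` and
`w₂` backwards from `π` uses decaying exponentials only, and couples the endpoint values by the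
small factor `exp (-s π)`. The boundary conditions thus become a small perturbation of a `2 × 2`
system whose determinant is, up to a nonzero factor, one of the two numbers in the definition of
regularity. Hence for large `τ` the Green function of the unperturbed problem is dominated by
`expKernel τ` (`exists_green_bound`).

With a potential, the resolvent equation reads `y = G (F - Q y)`, where `G` is the unperturbed
solution operator. Because `Q` is only in `L₁`, the equation is solved in the uniform norm: the
kernel applied to `|Q|` tends to `0` uniformly as `τ → ∞`, so `y ↦ G (F - Q y)` is a contraction on
continuous functions. This gives `sup ‖y‖ = O(τ^(-1/2)) ‖F‖`. For the `L₂` norm, Schur's test gives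
`O(τ⁻¹)` for `G F`. In `G Q y` one factor `τ^(-1/2)` comes from the uniform bound of `y` and another
from the `L₂` norm of the kernel applied to `|Q|` (`exists_solution_bound`).

Solutions with `‖F‖ ≤ 1` are uniformly bounded and equicontinuous, so the resolvent is compact by
Arzelà–Ascoli. Discreteness then follows from Riesz theory: one lemma on chains of invariant
subspaces excludes both infinitely many spectral points in a disc and infinitely growing root
subspaces. -/

noncomputable section

namespace Dirac

/-! ### Riesz theory for an unbounded operator with compact resolvent -/

section Unbounded

variable {H : Type*} [NormedAddCommGroup H] [NormedSpace ℂ H]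

/-- An operator `T - z` that is onto and bounded below has a resolvent, with the norm bound given
by the lower bound. -/
theorem exists_isResolventAt (T : H →ₗ.[ℂ] H) (z : ℂ) {C : ℝ} (hC : 0 ≤ C)
    (hsurj : ∀ f : H, ∃ y : T.domain, T y - z • (y : H) = f)
    (hbound : ∀ y : T.domain, ‖(y : H)‖ ≤ C * ‖T y - z • (y : H)‖) :
    ∃ R : H →L[ℂ] H, IsResolventAt T z R ∧ ‖R‖ ≤ C := by
  let A : T.domain →ₗ[ℂ] H := T.toFun - z • T.domain.subtype
  have hA : ∀ y : T.domain, A y = T y - z • (y : H) := fun y => rfl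
  have hinj : Function.Injective A := by
    rw [← LinearMap.ker_eq_bot, LinearMap.ker_eq_bot']
    intro y hy
    have := hbound y
    rw [← hA, hy, norm_zero, mul_zero] at this
    exact Subtype.ext (norm_le_zero_iff.1 this)
  let e : T.domain ≃ₗ[ℂ] H := LinearEquiv.ofBijective A ⟨hinj, hsurj⟩
  have he : ∀ f, T (e.symm f) - z • (e.symm f : H) = f := fun f => e.apply_symm_apply f
  let R : H →L[ℂ] H := (T.domain.subtype ∘ₗ e.symm.toLinearMap).mkContinuous C fun f => by
    have := hbound (e.symm f)
    rwa [he] at this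
  refine ⟨R, ⟨fun f => ⟨(e.symm f).2, he f⟩, fun y => ?_⟩, LinearMap.mkContinuous_norm_le _ hC _⟩
  exact congrArg Subtype.val (e.symm_apply_apply y)

/-- A compact operator has no infinite strictly increasing chain of closed invariant subspaces on
whose successive quotients it acts as scalars bounded away from zero. -/
theorem not_strict_chain_of_isCompactOperator {K : H →L[ℂ] H} (hK : IsCompactOperator K)
    {E : ℕ → Submodule ℂ H} (hcl : ∀ n, IsClosed (E n : Set H)) (hlt : ∀ n, E n < E (n + 1))
    {μ : ℕ → ℂ} {δ : ℝ} (hδ : 0 < δ) (hμ : ∀ n, δ ≤ ‖μ n‖)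
    (hinv : ∀ n, ∀ x ∈ E n, K x ∈ E n) (hquot : ∀ n, ∀ x ∈ E (n + 1), K x - μ n • x ∈ E n) :
    False := by
  have hmono : Monotone E := monotone_nat_of_le_succ fun n => (hlt n).le
  -- Riesz's lemma inside `E (n + 1)`: bounded vectors at distance at least `1` from the previous
  -- subspace.
  have hex : ∀ n, ∃ x ∈ E (n + 1), ‖x‖ ≤ 3 ∧ ∀ y ∈ E n, 1 ≤ ‖x - y‖ := by
    intro n
    obtain ⟨v, hv, hv'⟩ := SetLike.exists_of_lt (hlt n)
    obtain ⟨x, hx, hxy⟩ := riesz_lemma_of_norm_lt (𝕜 := ℂ) (E := E (n + 1)) (c := 2) (R := 3)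
      (F := (E n).comap (E (n + 1)).subtype) (by norm_num) (by norm_num)
      ((hcl n).preimage continuous_subtype_val) ⟨⟨v, hv⟩, hv'⟩
    exact ⟨x, x.2, hx, fun y hy => hxy ⟨y, (hlt n).le hy⟩ hy⟩
  choose x hxE hx3 hx1 using hex
  -- For `m < n`, modulo `E n` the difference `K (x n) - K (x m)` is `μ n • x n`. The images are
  -- therefore `δ`-separated and have no convergent subsequence.
  have hsep : ∀ m n, m < n → δ ≤ ‖K (x n) - K (x m)‖ := by
    intro m n hmn
    have hμ0 : μ n ≠ 0 := norm_pos_iff.1 (hδ.trans_le (hμ n))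
    have hu : (μ n)⁻¹ • (K (x m) - (K (x n) - μ n • x n)) ∈ E n := by
      refine Submodule.smul_mem _ _ (Submodule.sub_mem _ ?_ (hquot n _ (hxE n)))
      exact hinv n _ (hmono hmn (hxE m))
    have h1 := hx1 n _ hu
    have e : K (x n) - K (x m) =
        μ n • (x n - (μ n)⁻¹ • (K (x m) - (K (x n) - μ n • x n))) := by
      rw [smul_sub, smul_inv_smul₀ hμ0]
      abel
    rw [e, norm_smul]
    calc δ ≤ ‖μ n‖ := hμ n
      _ ≤ _ := le_mul_of_one_le_right (norm_nonneg _) h1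
  obtain ⟨S, hS, hS'⟩ := hK.image_closedBall_subset_compact 3
  obtain ⟨y, -, ψ, hψ, hψy⟩ := hS.tendsto_subseq
    (fun n => hS' ⟨x n, by simpa using hx3 n, rfl⟩)
  have hc := hψy.cauchySeq
  rw [Metric.cauchySeq_iff'] at hc
  obtain ⟨N, hN⟩ := hc δ hδ
  have h1 := hN (N + 1) (Nat.le_succ N)
  rw [dist_eq_norm] at h1
  exact absurd h1 (not_lt.2 (hsep _ _ (hψ (Nat.lt_succ_self N))))

/-- `K` restricts to the identity on this closed subspace, and a space with compact identity is
finite-dimensional. -/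
theorem finiteDimensional_ker_one_sub {K : H →L[ℂ] H} (hK : IsCompactOperator K) :
    FiniteDimensional ℂ (LinearMap.ker ((1 - K : H →L[ℂ] H) : H →ₗ[ℂ] H)) := by
  set V := LinearMap.ker ((1 - K : H →L[ℂ] H) : H →ₗ[ℂ] H)
  have hV : ∀ x ∈ V, K x = x := by
    intro x hx
    have : x - K x = 0 := hx
    exact (sub_eq_zero.1 this).symm
  have hVc : IsClosed (V : Set H) := (1 - K : H →L[ℂ] H).isClosed_ker
  have hmaps : ∀ x ∈ V, (K : H →ₗ[ℂ] H) x ∈ V := fun x hx => by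
    rw [ContinuousLinearMap.coe_coe, hV x hx]; exact hx
  have hid := IsCompactOperator.restrict (f := (K : H →ₗ[ℂ] H)) hK hmaps hVc
  have e : ((K : H →ₗ[ℂ] H).restrict hmaps : V → V) = id := by
    funext x
    exact Subtype.ext (hV x x.2)
  rw [e] at hid
  exact FiniteDimensional.of_isCompactOperator_id hid

/-- Compact operators form an ideal, so only the leading `1` of the expansion is not compact. This
reduces kernels of powers to `finiteDimensional_ker_one_sub`. -/
theorem exists_pow_one_sub_eq {K : H →L[ℂ] H} (hK : IsCompactOperator K) (n : ℕ) :
    ∃ K' : H →L[ℂ] H, IsCompactOperator K' ∧ (1 - K) ^ n = 1 - K' := by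
  induction n with
  | zero => exact ⟨0, isCompactOperator_zero, by simp⟩
  | succ n ih =>
    obtain ⟨K', hK', e⟩ := ih
    refine ⟨K' + K - K' * K, (hK'.add hK).sub (hK'.comp_clm K), ?_⟩
    rw [pow_succ, e]
    noncomm_ring

/-- The root subspace of a compact operator at a nonzero eigenvalue `ζ⁻¹` is finite-dimensional. -/
theorem finiteDimensional_iSup_ker_pow {K : H →L[ℂ] H} (hK : IsCompactOperator K) {ζ : ℂ}
    (hζ : ζ ≠ 0) :
    FiniteDimensional ℂ (⨆ n, LinearMap.ker (((1 - ζ • K) ^ n : H →L[ℂ] H) : H →ₗ[ℂ] H) :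
      Submodule ℂ H) := by
  set E : ℕ → Submodule ℂ H :=
    fun n => LinearMap.ker (((1 - ζ • K) ^ n : H →L[ℂ] H) : H →ₗ[ℂ] H)
  have hE : ∀ n x, x ∈ E n ↔ ((1 - ζ • K) ^ n) x = 0 := fun n x => Iff.rfl
  have hEs : ∀ n x, x ∈ E (n + 1) ↔ (1 - ζ • K) x ∈ E n := fun n x => by
    rw [hE, hE, pow_succ]; rfl
  have hmono : Monotone E := monotone_nat_of_le_succ fun n x hx => by
    rw [hE, pow_succ', mul_apply_eq_comp, (hE n x).1 hx, map_zero]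
  -- Since `1 - ζ • K` maps `E (n + 1)` into `E n`, the operator `K` acts on the quotient as `ζ⁻¹`;
  -- endless strict growth would be a forbidden chain.
  have hstab : ∃ n, E (n + 1) = E n := by
    by_contra! h
    refine not_strict_chain_of_isCompactOperator hK (E := E) (μ := fun _ => ζ⁻¹) (δ := ‖ζ⁻¹‖)
      (fun n => ((1 - ζ • K) ^ n : H →L[ℂ] H).isClosed_ker)
      (fun n => lt_of_le_of_ne (hmono (Nat.le_succ n)) (h n).symm)
      (norm_pos_iff.2 (inv_ne_zero hζ)) (fun _ => le_rfl) ?_ ?_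
    · intro n x hx
      have hcomm : Commute ((1 - ζ • K) ^ n) K :=
        ((Commute.one_left K).sub_left ((Commute.refl K).smul_left ζ)).pow_left n
      rw [hE, ← mul_apply_eq_comp, hcomm.eq, mul_apply_eq_comp,
        (hE n x).1 hx, map_zero]
    · intro n x hx
      have : K x - ζ⁻¹ • x = -(ζ⁻¹ • (1 - ζ • K) x) := by
        simp [smul_sub, smul_smul, hζ]
      rw [this]
      exact Submodule.neg_mem _ (Submodule.smul_mem _ _ ((hEs n x).1 hx))
  obtain ⟨N, hN⟩ := hstab
  have hstep : ∀ k, E (N + k) = E N := by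
    intro k
    induction k with
    | zero => rfl
    | succ k ih =>
      refine le_antisymm (fun x hx => ?_) (hmono (by omega))
      have h1 : (1 - ζ • K) x ∈ E (N + k) := (hEs (N + k) x).1 hx
      rw [ih] at h1
      rw [← hN]
      exact (hEs N x).2 h1
  have hsup : ⨆ n, E n = E N := by
    refine le_antisymm (iSup_le fun n => ?_) (le_iSup E N)
    calc E n ≤ E (N + n) := hmono (by omega)
      _ = E N := hstep n
  rw [hsup]
  obtain ⟨K', hK', e⟩ := exists_pow_one_sub_eq (K := ζ • K) (hK.smul ζ) N
  change FiniteDimensional ℂ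
    (LinearMap.ker (((1 - ζ • K) ^ N : H →L[ℂ] H) : H →ₗ[ℂ] H))
  rw [e]
  exact finiteDimensional_ker_one_sub hK'

namespace IsResolventAt

variable {T : H →ₗ.[ℂ] H} {z₀ : ℂ} {R : H →L[ℂ] H}

/-- `y ∈ D(T)` is `R w` with `w = (T - z₀) y`, and `(T - z) y = w - (z - z₀) R w`. -/
theorem exists_eq_apply (h : IsResolventAt T z₀ R) (z : ℂ) (y : T.domain) :
    ∃ w, R w = y ∧ T y - z • (y : H) = (1 - (z - z₀) • R) w := by
  refine ⟨T y - z₀ • (y : H), h.2 y, ?_⟩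
  simp only [sub_apply, one_apply_eq_self,
    smul_apply, h.2 y, sub_smul]
  abel

/-- An invertible `1 - (z - z₀) R` gives the resolvent at `z`. -/
theorem of_isUnit (h : IsResolventAt T z₀ R) {z : ℂ} (hu : IsUnit (1 - (z - z₀) • R)) :
    ∃ R', IsResolventAt T z R' := by
  obtain ⟨u, hu⟩ := hu
  have h1 : ∀ f, (1 - (z - z₀) • R) ((↑u⁻¹ : H →L[ℂ] H) f) = f := fun f => by
    rw [← hu, ← mul_apply_eq_comp, Units.mul_inv]; rfl
  have h2 : ∀ f, (↑u⁻¹ : H →L[ℂ] H) ((1 - (z - z₀) • R) f) = f := fun f => by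
    rw [← hu, ← mul_apply_eq_comp, Units.inv_mul]; rfl
  -- The resolvent identity: `(T - z)⁻¹ = R (1 - (z - z₀) R)⁻¹`.
  refine ⟨R * ↑u⁻¹, fun f => ?_, fun y => ?_⟩
  · obtain ⟨hd, e⟩ := h.1 ((↑u⁻¹ : H →L[ℂ] H) f)
    refine ⟨hd, ?_⟩
    have h3 := h1 f
    simp only [sub_apply, one_apply_eq_self,
      smul_apply, sub_smul] at h3
    simp only [mul_apply_eq_comp]
    rw [sub_eq_iff_eq_add] at e
    rw [e]
    refine Eq.trans ?_ h3
    abel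
  · obtain ⟨w, hw, e⟩ := h.exists_eq_apply z y
    rw [e, mul_apply_eq_comp, h2, hw]

/-- Writing `y = R w` turns `(T - z) y` into `(1 - (z - z₀) R) w`. As `R` commutes with this factor,
each application of `T - z` costs one power of a bounded operator, to which the compact theory
applies. -/
theorem kerPow_le (h : IsResolventAt T z₀ R) (z : ℂ) (n : ℕ) :
    kerPow T z n ≤ LinearMap.ker (((1 - (z - z₀) • R) ^ n : H →L[ℂ] H) : H →ₗ[ℂ] H) := by
  induction n with
  | zero => exact bot_le
  | succ n ih =>
    rintro _ ⟨y, hy, rfl⟩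
    obtain ⟨w, hw, e⟩ := h.exists_eq_apply z y
    have h1 : ((1 - (z - z₀) • R) ^ n) (T y - z • (y : H)) = 0 := ih hy
    rw [e, ← mul_apply_eq_comp, ← pow_succ] at h1
    have hcomm : Commute ((1 - (z - z₀) • R) ^ (n + 1)) R :=
      ((Commute.one_left R).sub_left ((Commute.refl R).smul_left _)).pow_left _
    change ((1 - (z - z₀) • R) ^ (n + 1)) (y : H) = 0
    rw [← hw, ← mul_apply_eq_comp, hcomm.eq, mul_apply_eq_comp, h1,
      map_zero]

variable [CompleteSpace H]

/-- The Fredholm alternative for `R` at `(z - z₀)⁻¹`: if this is not an eigenvalue, then `1 - (z -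
z₀) R` is invertible and `z` is not in the spectrum. -/
theorem exists_eigenvector (h : IsResolventAt T z₀ R) (hR : IsCompactOperator R) {z : ℂ}
    (hz : z ∈ spectrum T) : ∃ y : T.domain, (y : H) ≠ 0 ∧ T y = z • (y : H) := by
  have hne : z - z₀ ≠ 0 := fun e => hz ⟨R, by rwa [sub_eq_zero.1 e]⟩
  rcases hR.hasEigenvalue_or_mem_resolventSet (inv_ne_zero hne) with h1 | h1
  · obtain ⟨x, hx⟩ := h1.exists_hasEigenvector
    have hx1 : R x = (z - z₀)⁻¹ • x := hx.apply_eq_smul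
    obtain ⟨hd, e⟩ := h.1 x
    have hx2 : x = (z - z₀) • R x := by rw [hx1, smul_inv_smul₀ hne]
    refine ⟨⟨R x, hd⟩, fun h0 => hx.2 ?_, ?_⟩
    · rw [hx2]; exact smul_eq_zero_of_right _ h0
    · rw [sub_eq_iff_eq_add] at e
      rw [e]
      nth_rewrite 1 [hx2]
      rw [← add_smul]
      simp
  · refine absurd (h.of_isUnit (z := z) ?_) hz
    rw [spectrum.mem_resolventSet_iff] at h1
    have h2 := h1.smul (Units.mk0 _ hne)
    convert h2 using 1
    rw [Units.smul_mk0, smul_sub, Algebra.algebraMap_eq_smul_one, smul_inv_smul₀ hne]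

theorem hasDiscreteSpectrum (h : IsResolventAt T z₀ R) (hR : IsCompactOperator R) :
    HasDiscreteSpectrum T where
  compact_resolvent := ⟨z₀, R, h, hR⟩
  isEigenvalue z hz := h.exists_eigenvector hR hz
  finite_multiplicity z hz := by
    have hne : z - z₀ ≠ 0 := fun e => hz ⟨R, by rwa [sub_eq_zero.1 e]⟩
    have := finiteDimensional_iSup_ker_pow hR hne
    exact Submodule.finiteDimensional_of_le (iSup_mono fun n => h.kerPow_le z n)
  finite_inter_closedBall r := by
    by_contra hinf
    let z := Set.Infinite.natEmbedding _ hinf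
    have hz : ∀ n, (z n : ℂ) ∈ spectrum T := fun n => (z n).2.1
    have hne : ∀ n, (z n : ℂ) - z₀ ≠ 0 := fun n e => hz n ⟨R, by rwa [sub_eq_zero.1 e]⟩
    choose y hy0 hy using fun n => h.exists_eigenvector hR (hz n)
    have hRy : ∀ n, R (y n) = ((z n : ℂ) - z₀)⁻¹ • (y n : H) := by
      intro n
      have := h.2 (y n)
      rw [hy, ← sub_smul, map_smul] at this
      rw [eq_inv_smul_iff₀ (hne n), this]
    have hinj : Function.Injective fun n => ((z n : ℂ) - z₀)⁻¹ := by
      intro m n hmn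
      exact z.injective (Subtype.ext (sub_left_injective (inv_injective hmn)))
    have hli : LinearIndependent ℂ fun n => (y n : H) :=
      Module.End.eigenvectors_linearIndependent' (R : H →ₗ[ℂ] H) _ hinj _ fun n =>
        ⟨Module.End.mem_eigenspace_iff.2 (hRy n), hy0 n⟩
    let E : ℕ → Submodule ℂ H := fun n => Submodule.span ℂ ((fun k => (y k : H)) '' Iio n)
    have hyE : ∀ k n, k < n → (y k : H) ∈ E n := fun k n hk =>
      Submodule.subset_span ⟨k, hk, rfl⟩
    have hmono : ∀ n, E n ≤ E (n + 1) := fun n =>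
      Submodule.span_mono (image_mono (Iio_subset_Iio (Nat.le_succ n)))
    have hfin : ∀ n, FiniteDimensional ℂ (E n) := fun n =>
      FiniteDimensional.span_of_finite ℂ ((finite_Iio n).image _)
    -- Spans of eigenvectors for distinct eigenvalues form the chain, and `R` acts on the quotients
    -- as `(z n - z₀)⁻¹`. These stay away from `0` because `‖z n - z₀‖ ≤ |r| + ‖z₀‖`.
    refine not_strict_chain_of_isCompactOperator hR (E := E)
      (μ := fun n => ((z n : ℂ) - z₀)⁻¹) (δ := (|r| + ‖z₀‖ + 1)⁻¹)
      (fun n => (E n).closed_of_finiteDimensional) (fun n => ?_) (by positivity) (fun n => ?_)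
      (fun n => ?_) (fun n => ?_)
    · refine lt_of_le_of_ne (hmono n) fun e => ?_
      have h1 := hyE n (n + 1) (Nat.lt_succ_self n)
      rw [← e] at h1
      exact hli.notMem_span_image (s := Iio n) (by simp) h1
    · rw [norm_inv]
      refine inv_anti₀ (norm_pos_iff.2 (hne n)) ?_
      have h1 : ‖(z n : ℂ)‖ ≤ r := by simpa using (z n).2.2
      have := norm_sub_le (z n : ℂ) z₀
      have := le_abs_self r
      linarith
    · change E n ≤ (E n).comap (R : H →ₗ[ℂ] H)
      refine Submodule.span_le.2 ?_
      rintro _ ⟨k, hk, rfl⟩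
      change R (y k) ∈ E n
      rw [hRy]
      exact Submodule.smul_mem _ _ (hyE k n hk)
    · change E (n + 1) ≤ (E n).comap ((R : H →ₗ[ℂ] H) - ((z n : ℂ) - z₀)⁻¹ • LinearMap.id)
      refine Submodule.span_le.2 ?_
      rintro _ ⟨k, hk, rfl⟩
      change R (y k) - ((z n : ℂ) - z₀)⁻¹ • (y k : H) ∈ E n
      rw [hRy, ← sub_smul]
      rcases (Nat.lt_succ_iff.1 hk).lt_or_eq with h1 | h1
      · exact Submodule.smul_mem _ _ (hyE k n h1)
      · simp [h1]

end IsResolventAt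

end Unbounded

end Dirac

end

noncomputable section

namespace Dirac

/-! ### Vector-valued absolutely continuous functions -/

section AbsolutelyContinuous

variable {X Y : Type*} [PseudoMetricSpace X] [PseudoMetricSpace Y]
  {E : Type*} [NormedAddCommGroup E] [NormedSpace ℝ E]

theorem absolutelyContinuousOnInterval_of_dist_le {f : ℝ → X} {g : ℝ → Y} {a b : ℝ}
    (hg : AbsolutelyContinuousOnInterval g a b)
    (h : ∀ x ∈ uIcc a b, ∀ y ∈ uIcc a b, dist (f x) (f y) ≤ dist (g x) (g y)) :
    AbsolutelyContinuousOnInterval f a b := by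
  rw [absolutelyContinuousOnInterval_iff] at hg ⊢
  intro ε hε
  obtain ⟨δ, hδ, H⟩ := hg ε hε
  refine ⟨δ, hδ, fun I hI hlt => lt_of_le_of_lt (Finset.sum_le_sum fun i hi => ?_) (H I hI hlt)⟩
  exact h _ (hI.1 i hi).1 _ (hI.1 i hi).2

/-- The increments are dominated by those of the real primitive of `‖f‖`. -/
theorem absolutelyContinuousOnInterval_integral [CompleteSpace E] {f : ℝ → E} {a b c : ℝ}
    (hf : IntervalIntegrable f volume a b) (hc : c ∈ uIcc a b) :
    AbsolutelyContinuousOnInterval (fun x => ∫ t in c..x, f t) a b := by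
  refine absolutelyContinuousOnInterval_of_dist_le
    (hf.norm.absolutelyContinuousOnInterval_intervalIntegral hc) fun x hx y hy => ?_
  have hi : ∀ u ∈ uIcc a b, ∀ v ∈ uIcc a b, IntervalIntegrable f volume u v :=
    fun u hu v hv => hf.mono_set (uIcc_subset_uIcc hu hv)
  rw [dist_eq_norm, dist_eq_norm,
    intervalIntegral.integral_interval_sub_left (hi c hc x hx) (hi c hc y hy),
    intervalIntegral.integral_interval_sub_left (hi c hc x hx).norm (hi c hc y hy).norm]
  exact intervalIntegral.norm_integral_le_abs_integral_norm

/-- The fundamental theorem of calculus for vector-valued absolutely continuous functions. -/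
theorem eq_add_integral_of_ae_hasDerivAt [CompleteSpace E] {f f' : ℝ → E} {a b c : ℝ}
    (hf : AbsolutelyContinuousOnInterval f a b) (hf' : IntervalIntegrable f' volume a b)
    (hd : ∀ᵐ x, x ∈ uIcc a b → HasDerivAt f (f' x) x) (hc : c ∈ uIcc a b) {x : ℝ}
    (hx : x ∈ uIcc a b) : f x = f c + ∫ t in c..x, f' t := by
  -- The difference of `f` and the primitive is absolutely continuous with a.e. zero derivative,
  -- hence constant.
  have hac := hf.sub (absolutelyContinuousOnInterval_integral hf' hc)
  obtain ⟨C, hC⟩ := hac.const_of_ae_hasDerivAt_zero (by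
    filter_upwards [hd, hf'.ae_hasDerivAt_integral] with t h1 h2 ht
    simpa using (h1 ht).sub (h2 ht c hc))
  have h1 := hC x hx
  have h2 := hC c hc
  simp only [Pi.sub_apply, intervalIntegral.integral_same, sub_zero] at h1 h2
  rw [h2, ← h1]
  abel

end AbsolutelyContinuous

/-! ### The scalar equation `w' = r w + g` -/

section ScalarEquation

variable {a b c : ℝ} {r : ℂ} {g w : ℝ → ℂ}

theorem hasDerivAt_exp_mul_sub (r : ℂ) (c x : ℝ) :
    HasDerivAt (fun t : ℝ => Complex.exp (r * (t - c))) (r * Complex.exp (r * (x - c))) x := by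
  have h : HasDerivAt (fun t : ℝ => r * ((t : ℂ) - c)) (r * 1) x :=
    ((Complex.ofRealCLM.hasDerivAt (x := x)).sub_const (c : ℂ)).const_mul r
  simpa [mul_comm] using h.cexp

theorem contDiff_exp_mul_sub (r : ℂ) (c : ℝ) :
    ContDiff ℝ 1 fun t : ℝ => Complex.exp (r * (t - c)) := by
  have h : ContDiff ℝ 1 fun t : ℝ => (t : ℂ) := Complex.ofRealCLM.contDiff
  exact (contDiff_const.mul (h.sub contDiff_const)).cexp

/-- Variation of constants: the solution of `w' = r w + g`. -/
theorem eq_exp_mul_add_integral (hw : AbsolutelyContinuousOnInterval w a b)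
    (hg : IntervalIntegrable g volume a b)
    (hd : ∀ᵐ x, x ∈ uIcc a b → HasDerivAt w (r * w x + g x) x) (hc : c ∈ uIcc a b) {x : ℝ}
    (hx : x ∈ uIcc a b) :
    w x = Complex.exp (r * (x - c)) * w c + ∫ t in c..x, Complex.exp (r * (x - t)) * g t := by
  have hE : AbsolutelyContinuousOnInterval (fun t : ℝ => Complex.exp (-r * (t - c))) a b :=
    (contDiff_exp_mul_sub (-r) c).contDiffOn.absolutelyContinuousOnInterval
  have hEc : Continuous (fun t : ℝ => Complex.exp (-r * (t - c))) :=
    (contDiff_exp_mul_sub (-r) c).continuous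
  -- Integrating factor: `exp (-r (t - c)) w` has derivative `exp (-r (t - c)) g`.
  have h := eq_add_integral_of_ae_hasDerivAt (hE.smul hw)
    (f' := fun t => Complex.exp (-r * (t - c)) * g t) (hg.continuousOn_mul hEc.continuousOn) (by
      filter_upwards [hd] with t h1 ht
      have h2 := (hasDerivAt_exp_mul_sub (-r) c t).mul (h1 ht)
      exact h2.congr_deriv (by ring)) hc hx
  simp only [Pi.smul_apply', smul_eq_mul, sub_self, mul_zero, Complex.exp_zero, one_mul] at h
  have h3 : w x = Complex.exp (r * (x - c)) * (Complex.exp (-r * (x - c)) * w x) := by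
    rw [← mul_assoc, ← Complex.exp_add]
    simp
  rw [h3, h, mul_add, ← intervalIntegral.integral_const_mul]
  congr 1
  refine intervalIntegral.integral_congr fun t _ => ?_
  rw [← mul_assoc, ← Complex.exp_add]
  congr 2
  ring

/-- The base point `c` is free because the decaying component is prescribed at `0` and the growing
one at `π`. -/
theorem exists_solution (r : ℂ) (hg : IntervalIntegrable g volume a b) (hc : c ∈ uIcc a b)
    (w₀ : ℂ) : ∃ w : ℝ → ℂ, w c = w₀ ∧ AbsolutelyContinuousOnInterval w a b ∧
      ∀ᵐ x, x ∈ uIcc a b → HasDerivAt w (r * w x + g x) x := by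
  have hE : AbsolutelyContinuousOnInterval (fun t : ℝ => Complex.exp (r * (t - c))) a b :=
    (contDiff_exp_mul_sub r c).contDiffOn.absolutelyContinuousOnInterval
  have hEc : Continuous (fun t : ℝ => Complex.exp (-r * (t - c))) :=
    (contDiff_exp_mul_sub (-r) c).continuous
  have hi : IntervalIntegrable (fun t => Complex.exp (-r * (t - c)) * g t) volume a b :=
    hg.continuousOn_mul hEc.continuousOn
  have hconst : AbsolutelyContinuousOnInterval (fun _ : ℝ => w₀) a b :=
    contDiffOn_const.absolutelyContinuousOnInterval
  refine ⟨(fun t : ℝ => Complex.exp (r * (t - c))) • ((fun _ => w₀) +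
    fun x => ∫ t in c..x, Complex.exp (-r * (t - c)) * g t), by simp,
    hE.smul (hconst.add (absolutelyContinuousOnInterval_integral hi hc)), ?_⟩
  filter_upwards [hi.ae_hasDerivAt_integral] with x h1 hx
  have h2 := (hasDerivAt_exp_mul_sub r c x).mul ((h1 hx c hc).const_add w₀)
  refine h2.congr_deriv ?_
  rw [← mul_assoc (Complex.exp (r * (x - c))), ← Complex.exp_add]
  simp only [Pi.smul_apply', smul_eq_mul, Pi.add_apply, neg_mul, add_neg_cancel,
    Complex.exp_zero, one_mul]
  ring

end ScalarEquation

end Dirac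

end

noncomputable section

namespace Dirac

/-! ### Cauchy–Schwarz and Schur's test -/

section Schur

open scoped ENNReal

variable {α β : Type*} [MeasurableSpace α] [MeasurableSpace β]

/-- The Cauchy–Schwarz inequality for the Lebesgue integral. -/
theorem sq_lintegral_mul_le {μ : Measure α} {f g : α → ℝ≥0∞} (hf : AEMeasurable f μ)
    (hg : AEMeasurable g μ) :
    (∫⁻ t, f t * g t ∂μ) ^ 2 ≤ (∫⁻ t, f t ^ 2 ∂μ) * ∫⁻ t, g t ^ 2 ∂μ := by
  have h := ENNReal.lintegral_mul_le_Lp_mul_Lq μ Real.HolderConjugate.two_two hf hg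
  simp only [ENNReal.rpow_two] at h
  calc (∫⁻ t, f t * g t ∂μ) ^ 2
      ≤ ((∫⁻ t, f t ^ 2 ∂μ) ^ (1 / 2 : ℝ) * (∫⁻ t, g t ^ 2 ∂μ) ^ (1 / 2 : ℝ)) ^ 2 := by
        gcongr; exact h
    _ = _ := by
        rw [mul_pow, ← ENNReal.rpow_two, ← ENNReal.rpow_two, ← ENNReal.rpow_mul,
          ← ENNReal.rpow_mul]
        norm_num

/-- Cauchy–Schwarz for the factorisation `k h = k^(1/2) · (k^(1/2) h)`. -/
theorem sq_lintegral_mul_le_weighted {μ : Measure α} {k h : α → ℝ≥0∞} (hk : AEMeasurable k μ)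
    (hh : AEMeasurable h μ) :
    (∫⁻ t, k t * h t ∂μ) ^ 2 ≤ (∫⁻ t, k t ∂μ) * ∫⁻ t, k t * h t ^ 2 ∂μ := by
  have hs : ∀ t, (k t ^ (1 / 2 : ℝ)) * (k t ^ (1 / 2 : ℝ)) = k t := fun t => by
    rw [← sq, ← ENNReal.rpow_two, ← ENNReal.rpow_mul]
    norm_num
  have h1 := sq_lintegral_mul_le (hk.pow_const (1 / 2 : ℝ)) ((hk.pow_const (1 / 2 : ℝ)).mul hh)
  simp only [Pi.mul_apply, ← mul_assoc, hs, mul_pow] at h1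
  simpa only [sq (_ ^ (1 / 2 : ℝ)), hs] using h1

/-- Schur's test. -/
theorem lintegral_sq_lintegral_mul_le {μ : Measure α} {ν : Measure β} [SFinite μ] [SFinite ν]
    {k : α → β → ℝ≥0∞} {h : β → ℝ≥0∞} (hk : Measurable (Function.uncurry k))
    (hh : AEMeasurable h ν) {A B : ℝ≥0∞} (hA : ∀ᵐ x ∂μ, ∫⁻ t, k x t ∂ν ≤ A)
    (hB : ∀ᵐ t ∂ν, ∫⁻ x, k x t ∂μ ≤ B) :
    ∫⁻ x, (∫⁻ t, k x t * h t ∂ν) ^ 2 ∂μ ≤ A * B * ∫⁻ t, h t ^ 2 ∂ν := by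
  have hkx : ∀ x, Measurable (k x) := fun x => hk.comp measurable_prodMk_left
  have hkt : ∀ t, Measurable fun x => k x t := fun t => hk.comp measurable_prodMk_right
  calc ∫⁻ x, (∫⁻ t, k x t * h t ∂ν) ^ 2 ∂μ
      ≤ ∫⁻ x, A * ∫⁻ t, k x t * h t ^ 2 ∂ν ∂μ := by
        refine lintegral_mono_ae ?_
        filter_upwards [hA] with x hx
        refine (sq_lintegral_mul_le_weighted (hkx x).aemeasurable hh).trans ?_
        gcongr
    _ ≤ A * ∫⁻ x, ∫⁻ t, k x t * h t ^ 2 ∂ν ∂μ := by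
        rw [lintegral_const_mul'']
        exact (hk.aemeasurable.mul (hh.pow_const 2).comp_snd).lintegral_prod_right'
    _ = A * ∫⁻ t, ∫⁻ x, k x t * h t ^ 2 ∂μ ∂ν := by
        rw [lintegral_lintegral_swap]
        exact hk.aemeasurable.mul (hh.pow_const 2).comp_snd
    _ ≤ A * ∫⁻ t, B * h t ^ 2 ∂ν := by
        gcongr 1
        refine lintegral_mono_ae ?_
        filter_upwards [hB] with t ht
        rw [lintegral_mul_const _ (hkt t)]
        gcongr
    _ = _ := by rw [lintegral_const_mul'' _ (hh.pow_const 2), mul_assoc]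

end Schur

/-! ### Estimates for the exponential kernel -/

section Kernel

open scoped ENNReal

/-- The kernel `∑ exp (-τ |x - t + kπ|)`, `k = 0, 1, -1`, which dominates the Green function of the
unperturbed operator. -/
def expKernel (τ x t : ℝ) : ℝ≥0∞ :=
  ENNReal.ofReal (Real.exp (-τ * |x - t|)) + ENNReal.ofReal (Real.exp (-τ * |x - t + Real.pi|)) +
    ENNReal.ofReal (Real.exp (-τ * |x - t - Real.pi|))

theorem lintegral_exp_neg_mul_abs {τ : ℝ} (hτ : 0 < τ) :
    ∫⁻ u : ℝ, ENNReal.ofReal (Real.exp (-τ * |u|)) = ENNReal.ofReal (2 / τ) := by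
  have h1 : ∫ u : ℝ, Real.exp (-τ * |u|) = 2 / τ := by
    rw [integral_comp_abs (f := fun u => Real.exp (-τ * u)),
      integral_exp_mul_Ioi (neg_lt_zero.2 hτ)]
    simp [div_eq_mul_inv]
  -- A non-integrable function has integral `0` by convention, which contradicts the value `2 / τ`.
  have h2 : Integrable fun u : ℝ => Real.exp (-τ * |u|) := by
    by_contra h
    rw [integral_undef h] at h1
    exact (div_pos two_pos hτ).ne h1
  rw [← h1, ofReal_integral_eq_lintegral_ofReal h2
    (Filter.Eventually.of_forall fun _ => (Real.exp_pos _).le)]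

theorem measurable_expKernel (τ : ℝ) : Measurable (Function.uncurry (expKernel τ)) := by
  unfold expKernel Function.uncurry
  fun_prop

theorem measurable_expKernel_right (τ x : ℝ) : Measurable (expKernel τ x) := by
  unfold expKernel
  fun_prop

theorem expKernel_comm (τ x t : ℝ) : expKernel τ x t = expKernel τ t x := by
  unfold expKernel
  rw [abs_sub_comm x t, show x - t + Real.pi = -(t - x - Real.pi) by ring,
    show x - t - Real.pi = -(t - x + Real.pi) by ring, abs_neg, abs_neg]
  ring

theorem expKernel_le {τ : ℝ} (hτ : 0 < τ) (x t : ℝ) : expKernel τ x t ≤ 3 := by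
  have h : ∀ u : ℝ, ENNReal.ofReal (Real.exp (-τ * |u|)) ≤ 1 := fun u => by
    rw [ENNReal.ofReal_le_one, Real.exp_le_one_iff, neg_mul, neg_nonpos]
    positivity
  calc expKernel τ x t ≤ 1 + 1 + 1 := add_le_add (add_le_add (h _) (h _)) (h _)
    _ = 3 := by norm_num

theorem lintegral_expKernel_le {τ : ℝ} (hτ : 0 < τ) (x : ℝ) (s : Set ℝ) :
    ∫⁻ t in s, expKernel τ x t ≤ ENNReal.ofReal (6 / τ) := by
  have h : ∀ c : ℝ, ∫⁻ t : ℝ, ENNReal.ofReal (Real.exp (-τ * |c - t|)) = ENNReal.ofReal (2 / τ) :=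
    fun c => by
      rw [← lintegral_exp_neg_mul_abs hτ]
      exact lintegral_sub_left_eq_self (fun u => ENNReal.ofReal (Real.exp (-τ * |u|))) c
  have e1 : ∀ t, x - t + Real.pi = (x + Real.pi) - t := fun t => by ring
  have e2 : ∀ t, x - t - Real.pi = (x - Real.pi) - t := fun t => by ring
  refine (setLIntegral_le_lintegral _ _).trans ?_
  simp only [expKernel, e1, e2]
  rw [lintegral_add_left (by fun_prop), lintegral_add_left (by fun_prop), h, h, h,
    ← ENNReal.ofReal_add (by positivity) (by positivity),
    ← ENNReal.ofReal_add (by positivity) (by positivity)]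
  refine ENNReal.ofReal_le_ofReal (le_of_eq ?_)
  ring

/-- The bound from `L₂` to the uniform norm. The kernel is at most `3` and has mass at most `6 / τ`,
so its square has mass at most `18 / τ`. -/
theorem sq_lintegral_expKernel_mul_le {τ : ℝ} (hτ : 0 < τ) (x : ℝ) {s : Set ℝ} {f : ℝ → ℝ≥0∞}
    (hf : AEMeasurable f (volume.restrict s)) :
    (∫⁻ t in s, expKernel τ x t * f t) ^ 2 ≤ ENNReal.ofReal (18 / τ) * ∫⁻ t in s, f t ^ 2 := by
  refine (sq_lintegral_mul_le (measurable_expKernel_right τ x).aemeasurable hf).trans ?_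
  gcongr
  calc ∫⁻ t in s, expKernel τ x t ^ 2 ≤ ∫⁻ t in s, 3 * expKernel τ x t := by
        refine lintegral_mono fun t => ?_
        rw [sq]
        exact mul_le_mul_left (expKernel_le hτ x t) _
    _ = 3 * ∫⁻ t in s, expKernel τ x t := lintegral_const_mul _ (measurable_expKernel_right τ x)
    _ ≤ 3 * ENNReal.ofReal (6 / τ) := by gcongr; exact lintegral_expKernel_le hτ x s
    _ = ENNReal.ofReal (18 / τ) := by
        rw [show (3 : ℝ≥0∞) = ENNReal.ofReal 3 by simp, ← ENNReal.ofReal_mul (by norm_num)]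
        congr 1
        ring

/-- The kernel acts on an integrable function uniformly small as `τ → ∞`. -/
theorem exists_lintegral_expKernel_mul_le {s : Set ℝ} {q : ℝ → ℝ≥0∞}
    (hq : AEMeasurable q (volume.restrict s)) (hfin : ∫⁻ t in s, q t ≠ ∞) {ε : ℝ≥0∞}
    (hε : 0 < ε) :
    ∃ τ₀ > 0, ∀ τ ≥ τ₀, ∀ x, ∫⁻ t in s, expKernel τ x t * q t ≤ ε := by
  -- Truncation at height `n`: subtraction is truncated at `0`, so `q - n` is the part of `q` above
  -- `n`, small in `L₁`. The bounded part is then handled by the mass `6 / τ` of the kernel.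
  have hlim : Filter.Tendsto (fun n : ℕ => ∫⁻ t in s, (q t - n)) Filter.atTop (nhds 0) := by
    rw [← lintegral_zero (μ := volume.restrict s)]
    refine tendsto_lintegral_of_dominated_convergence' q (fun n => hq.sub aemeasurable_const)
      (fun n => Filter.Eventually.of_forall fun t => tsub_le_self) hfin ?_
    filter_upwards [ae_lt_top' hq hfin] with t ht
    refine tendsto_const_nhds.congr' ?_
    obtain ⟨N, hN⟩ := ENNReal.exists_nat_gt ht.ne
    filter_upwards [Filter.eventually_ge_atTop N] with n hn
    exact (tsub_eq_zero_of_le (hN.le.trans (by exact_mod_cast hn))).symm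
  -- The kernel bound `3` turns `ε / 6` into half of `ε`.
  have hpos : 0 < ε / 6 := ENNReal.div_pos hε.ne' (by norm_num)
  obtain ⟨n, hn⟩ := (hlim.eventually_lt_const hpos).exists
  have hlim2 : Filter.Tendsto (fun τ : ℝ => ENNReal.ofReal (6 / τ) * n) Filter.atTop (nhds 0) := by
    have h1 : Filter.Tendsto (fun τ : ℝ => ENNReal.ofReal (6 / τ)) Filter.atTop (nhds 0) := by
      rw [← ENNReal.ofReal_zero]
      exact ENNReal.tendsto_ofReal (Filter.Tendsto.const_div_atTop Filter.tendsto_id _)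
    have h2 := ENNReal.Tendsto.mul_const (b := (n : ℝ≥0∞)) h1 (Or.inr (ENNReal.natCast_ne_top n))
    rwa [zero_mul] at h2
  have hpos2 : 0 < ε / 2 := ENNReal.div_pos hε.ne' (by norm_num)
  obtain ⟨τ₁, hτ₁⟩ := Filter.eventually_atTop.1 (hlim2.eventually_lt_const hpos2)
  refine ⟨max τ₁ 1, by positivity, fun τ hτ x => ?_⟩
  have hτ0 : 0 < τ := lt_of_lt_of_le (by positivity) hτ
  calc ∫⁻ t in s, expKernel τ x t * q t
      ≤ ∫⁻ t in s, (3 * (q t - n) + expKernel τ x t * n) := by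
        refine lintegral_mono fun t => ?_
        calc expKernel τ x t * q t ≤ expKernel τ x t * ((q t - n) + n) := by
              gcongr; exact le_tsub_add
          _ = expKernel τ x t * (q t - n) + expKernel τ x t * n := mul_add _ _ _
          _ ≤ _ := by gcongr; exact expKernel_le hτ0 x t
    _ = 3 * (∫⁻ t in s, (q t - n)) + (∫⁻ t in s, expKernel τ x t) * n := by
        rw [lintegral_add_right _ ((measurable_expKernel_right τ x).mul_const _),
          lintegral_const_mul'' (f := fun t => q t - n) _ (hq.sub aemeasurable_const),
          lintegral_mul_const _ (measurable_expKernel_right τ x)]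
    _ ≤ 3 * (ε / 6) + ENNReal.ofReal (6 / τ) * n := by
        gcongr
        exact lintegral_expKernel_le hτ0 x s
    _ ≤ ε / 2 + ε / 2 := by
        gcongr
        · rw [show (6 : ℝ≥0∞) = 3 * 2 by norm_num, ← ENNReal.mul_div_mul_left ε 2
            (by norm_num : (3 : ℝ≥0∞) ≠ 0) (by norm_num), mul_div_assoc]
        · exact (hτ₁ τ ((le_max_left _ _).trans hτ)).le
    _ = ε := ENNReal.add_halves ε

end Kernel

end Dirac

end

noncomputable section

namespace Dirac

/-! ### The diagonal system and its boundary conditions -/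

section Green

open scoped ENNReal

/-- Solvability, with a bound, of the boundary equations for the constants `c₁ = w₁(0)` and
`c₂ = w₂(π)`, where `w₁(π) = ε c₁ + a` and `w₂(0) = ε c₂ + b` with small `ε`. -/
theorem exists_boundary_solution {p₁ p₂ p₃ p₄ : Fin 2 → ℂ}
    (hdet : p₁ 0 * p₄ 1 - p₄ 0 * p₁ 1 ≠ 0) :
    ∃ K : ℝ, 0 ≤ K ∧ ∃ ρ > 0, ∀ ε : ℂ, ‖ε‖ ≤ ρ → ∀ a b : ℂ,
      (∃ c₁ c₂ : ℂ, ∀ i, p₁ i * c₁ + p₂ i * (ε * c₂ + b) + p₃ i * (ε * c₁ + a) + p₄ i * c₂ = 0) ∧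
      ∀ c₁ c₂ : ℂ, (∀ i, p₁ i * c₁ + p₂ i * (ε * c₂ + b) + p₃ i * (ε * c₁ + a) + p₄ i * c₂ = 0) →
        ‖c₁‖ ≤ K * (‖a‖ + ‖b‖) ∧ ‖c₂‖ ≤ K * (‖a‖ + ‖b‖) := by
  let D : ℂ → ℂ := fun ε =>
    (p₁ 0 + ε * p₃ 0) * (p₄ 1 + ε * p₂ 1) - (p₄ 0 + ε * p₂ 0) * (p₁ 1 + ε * p₃ 1)
  -- Cramer's rule: `D c = r`, with the right-hand sides bilinear in the coefficients
  let α : ℂ → ℂ := fun ε => (p₄ 0 + ε * p₂ 0) * p₃ 1 - p₃ 0 * (p₄ 1 + ε * p₂ 1)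
  let β : ℂ → ℂ := fun ε => (p₄ 0 + ε * p₂ 0) * p₂ 1 - p₂ 0 * (p₄ 1 + ε * p₂ 1)
  let γ : ℂ → ℂ := fun ε => p₃ 0 * (p₁ 1 + ε * p₃ 1) - (p₁ 0 + ε * p₃ 0) * p₃ 1
  let δ : ℂ → ℂ := fun ε => p₂ 0 * (p₁ 1 + ε * p₃ 1) - (p₁ 0 + ε * p₃ 0) * p₂ 1
  have hD0 : D 0 ≠ 0 := by simpa [D] using hdet
  -- At `ε = 0` the determinant `D` is the nonzero minor of the hypothesis, so Cramer's coefficients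
  -- stay bounded for small `ε`.
  have hcont : ContinuousAt (fun ε => ‖α ε / D ε‖ + ‖β ε / D ε‖ + ‖γ ε / D ε‖ + ‖δ ε / D ε‖) 0 := by
    have hDc : ContinuousAt D 0 := by fun_prop
    have hαc : ContinuousAt α 0 := by fun_prop
    have hβc : ContinuousAt β 0 := by fun_prop
    have hγc : ContinuousAt γ 0 := by fun_prop
    have hδc : ContinuousAt δ 0 := by fun_prop
    exact ((((hαc.div hDc hD0).norm.add (hβc.div hDc hD0).norm).add
      (hγc.div hDc hD0).norm).add (hδc.div hDc hD0).norm)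
  have hDne : ∀ᶠ ε in nhds (0 : ℂ), D ε ≠ 0 :=
    (show ContinuousAt D 0 by fun_prop).eventually_ne hD0
  obtain ⟨K, hK⟩ : ∃ K, ‖α 0 / D 0‖ + ‖β 0 / D 0‖ + ‖γ 0 / D 0‖ + ‖δ 0 / D 0‖ < K := exists_gt _
  obtain ⟨r, hr, H⟩ := Metric.eventually_nhds_iff.1 (hDne.and (hcont.eventually_lt_const hK))
  have hK0 : 0 ≤ K := le_trans (by positivity) hK.le
  refine ⟨K, hK0, r / 2, by positivity, fun ε hε a b => ?_⟩
  obtain ⟨hDε, hKε⟩ := H (y := ε) (by rw [dist_zero_right]; linarith)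
  have hα := norm_nonneg (α ε / D ε)
  have hβ := norm_nonneg (β ε / D ε)
  have hγ := norm_nonneg (γ ε / D ε)
  have hδ := norm_nonneg (δ ε / D ε)
  have hbound : ∀ u v : ℂ, ‖u‖ ≤ K → ‖v‖ ≤ K → ‖u * a + v * b‖ ≤ K * (‖a‖ + ‖b‖) := by
    intro u v hu hv
    calc ‖u * a + v * b‖ ≤ ‖u‖ * ‖a‖ + ‖v‖ * ‖b‖ := by
          rw [← norm_mul, ← norm_mul]; exact norm_add_le _ _
      _ ≤ K * ‖a‖ + K * ‖b‖ := by gcongr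
      _ = _ := by ring
  refine ⟨⟨α ε / D ε * a + β ε / D ε * b, γ ε / D ε * a + δ ε / D ε * b, fun i => ?_⟩,
    fun c₁ c₂ hc => ?_⟩
  · have e : ∀ X : ℂ, D ε * X = 0 → X = 0 := fun X hX => (mul_eq_zero.1 hX).resolve_left hDε
    apply e
    have h1 : ∀ u : ℂ, D ε * (u / D ε) = u := fun u => mul_div_cancel₀ u hDε
    have h2 : D ε * (p₁ i * (α ε / D ε * a + β ε / D ε * b) +
        p₂ i * (ε * (γ ε / D ε * a + δ ε / D ε * b) + b) +
        p₃ i * (ε * (α ε / D ε * a + β ε / D ε * b) + a) +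
        p₄ i * (γ ε / D ε * a + δ ε / D ε * b)) =
      p₁ i * (α ε * a + β ε * b) + p₂ i * (ε * (γ ε * a + δ ε * b) + D ε * b) +
        p₃ i * (ε * (α ε * a + β ε * b) + D ε * a) + p₄ i * (γ ε * a + δ ε * b) := by
      linear_combination (p₁ i * a + p₃ i * ε * a) * h1 (α ε) +
        (p₁ i * b + p₃ i * ε * b) * h1 (β ε) + (p₂ i * ε * a + p₄ i * a) * h1 (γ ε) +
        (p₂ i * ε * b + p₄ i * b) * h1 (δ ε)
    rw [h2]
    fin_cases i <;> simp only [D, α, β, γ, δ, Fin.zero_eta, Fin.mk_one] <;> ring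
  · have h0 := hc 0
    have h1 := hc 1
    have e1 : c₁ = α ε / D ε * a + β ε / D ε * b := by
      rw [div_mul_eq_mul_div, div_mul_eq_mul_div, ← add_div, eq_div_iff hDε]
      simp only [D, α, β]
      linear_combination (p₄ 1 + ε * p₂ 1) * h0 - (p₄ 0 + ε * p₂ 0) * h1
    have e2 : c₂ = γ ε / D ε * a + δ ε / D ε * b := by
      rw [div_mul_eq_mul_div, div_mul_eq_mul_div, ← add_div, eq_div_iff hDε]
      simp only [D, γ, δ]
      linear_combination (p₁ 0 + ε * p₃ 0) * h1 - (p₁ 1 + ε * p₃ 1) * h0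
    exact ⟨e1 ▸ hbound _ _ (by linarith) (by linarith), e2 ▸ hbound _ _ (by linarith) (by linarith)⟩

/-- A common majorant for all pieces of the Green function: `m` is an exponential prefactor from a
boundary term, and the limits are unordered because `w₂` is integrated from `π` backwards. -/
theorem enorm_mul_intervalIntegral_le {a b : ℝ} (ha : a ∈ Icc 0 Real.pi) (hb : b ∈ Icc 0 Real.pi)
    {k g : ℝ → ℂ} {m : ℂ} {Φ G : ℝ → ℝ≥0∞} (hk : ∀ t ∈ uIcc a b, ‖m * k t‖ₑ ≤ Φ t)
    (hg : ∀ t, ‖g t‖ₑ ≤ G t) :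
    ‖m * ∫ t in a..b, k t * g t‖ₑ ≤ ∫⁻ t in Icc 0 Real.pi, Φ t * G t := by
  have hsub : uIoc a b ⊆ Icc 0 Real.pi := uIoc_subset_uIcc.trans (uIcc_subset_Icc ha hb)
  rw [← intervalIntegral.integral_const_mul]
  calc ‖∫ t in a..b, m * (k t * g t)‖ₑ = ‖∫ t in uIoc a b, m * (k t * g t)‖ₑ := by
        rw [← ofReal_norm, ← ofReal_norm, intervalIntegral.norm_intervalIntegral_eq]
    _ ≤ ∫⁻ t in uIoc a b, ‖m * (k t * g t)‖ₑ := enorm_integral_le_lintegral_enorm _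
    _ ≤ ∫⁻ t in uIoc a b, Φ t * G t := by
        refine setLIntegral_mono' measurableSet_uIoc fun t ht => ?_
        rw [← mul_assoc, enorm_mul]
        exact mul_le_mul' (hk t (uIoc_subset_uIcc ht)) (hg t)
    _ ≤ _ := lintegral_mono_set hsub

theorem enorm_cexp (z : ℂ) : ‖Complex.exp z‖ₑ = ENNReal.ofReal (Real.exp z.re) := by
  rw [← ofReal_norm, Complex.norm_exp]

/-- A diagonal system on `[0,π]`: `w₁' = -s w₁ + g₁`, `w₂' = s w₂ + g₂`, with boundary conditions
`p₁ w₁(0) + p₂ w₂(0) + p₃ w₁(π) + p₄ w₂(π) = 0`. -/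
structure IsDiagonalSolution (p₁ p₂ p₃ p₄ : Fin 2 → ℂ) (s : ℂ) (g₁ g₂ w₁ w₂ : ℝ → ℂ) : Prop where
  ac₁ : AbsolutelyContinuousOnInterval w₁ 0 Real.pi
  ac₂ : AbsolutelyContinuousOnInterval w₂ 0 Real.pi
  deriv₁ : ∀ᵐ x, x ∈ uIcc 0 Real.pi → HasDerivAt w₁ (-s * w₁ x + g₁ x) x
  deriv₂ : ∀ᵐ x, x ∈ uIcc 0 Real.pi → HasDerivAt w₂ (s * w₂ x + g₂ x) x
  bc : ∀ i, p₁ i * w₁ 0 + p₂ i * w₂ 0 + p₃ i * w₁ Real.pi + p₄ i * w₂ Real.pi = 0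

/-- Variation of constants, from `0` for `w₁` and from `π` for `w₂`, leaves `c₁ = w₁(0)` and `c₂ =
w₂(π)` unknown. By `exists_boundary_solution` with `ε = exp (-s π)` they are controlled by the full
integrals `a` and `b`, so every term is an integral of a decaying exponential against `g₁` or `g₂`.
-/
theorem exists_diagonal_green_bound {p₁ p₂ p₃ p₄ : Fin 2 → ℂ}
    (hdet : p₁ 0 * p₄ 1 - p₄ 0 * p₁ 1 ≠ 0) :
    ∃ C : ℝ≥0∞, C ≠ ∞ ∧ ∃ τ₀ > 0, ∀ s : ℂ, τ₀ ≤ s.re → ∀ g₁ g₂ : ℝ → ℂ,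
      IntervalIntegrable g₁ volume 0 Real.pi → IntervalIntegrable g₂ volume 0 Real.pi →
      (∃ w₁ w₂, IsDiagonalSolution p₁ p₂ p₃ p₄ s g₁ g₂ w₁ w₂) ∧
      ∀ w₁ w₂, IsDiagonalSolution p₁ p₂ p₃ p₄ s g₁ g₂ w₁ w₂ → ∀ x ∈ Icc 0 Real.pi,
        ‖w₁ x‖ₑ + ‖w₂ x‖ₑ ≤
          C * ∫⁻ t in Icc 0 Real.pi, expKernel s.re x t * (‖g₁ t‖ₑ + ‖g₂ t‖ₑ) := by
  obtain ⟨K, hK0, ρ, hρ, H⟩ := exists_boundary_solution (p₂ := p₂) (p₃ := p₃) hdet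
  have hlim : Filter.Tendsto (fun τ : ℝ => Real.exp (-(τ * Real.pi))) Filter.atTop (nhds 0) :=
    Real.tendsto_exp_neg_atTop_nhds_zero.comp (Filter.tendsto_id.atTop_mul_const Real.pi_pos)
  obtain ⟨τ₁, hτ₁⟩ := Filter.eventually_atTop.1 (hlim.eventually_lt_const hρ)
  have hpi := Real.pi_pos
  have h0 : (0 : ℝ) ∈ Icc 0 Real.pi := ⟨le_rfl, hpi.le⟩
  have hπ : Real.pi ∈ Icc 0 Real.pi := ⟨hpi.le, le_rfl⟩
  -- Each component is an integral, bounded by one copy of the kernel integral, plus a boundary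
  -- term, bounded by `2 K` copies.
  refine ⟨4 * ENNReal.ofReal K + 2, by finiteness, max τ₁ 1, by positivity, ?_⟩
  intro s hs g₁ g₂ hg₁ hg₂
  set τ := s.re
  have hτ : 0 < τ := lt_of_lt_of_le (by positivity) hs
  set ε : ℂ := Complex.exp (-s * Real.pi)
  have hε : ‖ε‖ ≤ ρ := by
    rw [Complex.norm_exp]
    have := hτ₁ τ ((le_max_left _ _).trans hs)
    simpa [τ] using this.le
  set a : ℂ := ∫ t in (0 : ℝ)..Real.pi, Complex.exp (-s * (Real.pi - t)) * g₁ t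
  set b : ℂ := ∫ t in Real.pi..(0 : ℝ), Complex.exp (s * ((0 : ℝ) - t)) * g₂ t
  have hu : uIcc 0 Real.pi = Icc 0 Real.pi := uIcc_of_le hpi.le
  have r₁ : ∀ w : ℝ → ℂ, AbsolutelyContinuousOnInterval w 0 Real.pi →
      (∀ᵐ x, x ∈ uIcc 0 Real.pi → HasDerivAt w (-s * w x + g₁ x) x) → ∀ x ∈ Icc 0 Real.pi,
      w x = Complex.exp (-s * (x - (0 : ℝ))) * w 0 +
        ∫ t in (0 : ℝ)..x, Complex.exp (-s * (x - t)) * g₁ t := fun w hw hd x hx =>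
    eq_exp_mul_add_integral hw hg₁ hd (hu ▸ h0) (hu ▸ hx)
  have r₂ : ∀ w : ℝ → ℂ, AbsolutelyContinuousOnInterval w 0 Real.pi →
      (∀ᵐ x, x ∈ uIcc 0 Real.pi → HasDerivAt w (s * w x + g₂ x) x) → ∀ x ∈ Icc 0 Real.pi,
      w x = Complex.exp (s * (x - Real.pi)) * w Real.pi +
        ∫ t in Real.pi..x, Complex.exp (s * (x - t)) * g₂ t := fun w hw hd x hx =>
    eq_exp_mul_add_integral hw hg₂ hd (hu ▸ hπ) (hu ▸ hx)
  have b₁ : ∀ w : ℝ → ℂ, AbsolutelyContinuousOnInterval w 0 Real.pi →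
      (∀ᵐ x, x ∈ uIcc 0 Real.pi → HasDerivAt w (-s * w x + g₁ x) x) →
      w Real.pi = ε * w 0 + a := fun w hw hd => by
    rw [r₁ w hw hd Real.pi hπ]
    simp [ε, a]
  have b₂ : ∀ w : ℝ → ℂ, AbsolutelyContinuousOnInterval w 0 Real.pi →
      (∀ᵐ x, x ∈ uIcc 0 Real.pi → HasDerivAt w (s * w x + g₂ x) x) →
      w 0 = ε * w Real.pi + b := fun w hw hd => by
    rw [r₂ w hw hd 0 h0]
    simp [ε, b]
  constructor
  · obtain ⟨c₁, c₂, hc⟩ := (H ε hε a b).1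
    obtain ⟨w₁, hw₁, hac₁, hd₁⟩ := exists_solution (-s) hg₁ (hu ▸ h0) c₁
    obtain ⟨w₂, hw₂, hac₂, hd₂⟩ := exists_solution s hg₂ (hu ▸ hπ) c₂
    refine ⟨w₁, w₂, hac₁, hac₂, hd₁, hd₂, fun i => ?_⟩
    rw [b₁ w₁ hac₁ hd₁, b₂ w₂ hac₂ hd₂, hw₁, hw₂]
    exact hc i
  · intro w₁ w₂ hw x hx
    have hbc := hw.bc
    rw [b₁ w₁ hw.ac₁ hw.deriv₁, b₂ w₂ hw.ac₂ hw.deriv₂] at hbc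
    obtain ⟨hc₁, hc₂⟩ := (H ε hε a b).2 _ _ hbc
    set G : ℝ → ℝ≥0∞ := fun t => ‖g₁ t‖ₑ + ‖g₂ t‖ₑ
    set N : ℝ≥0∞ := ∫⁻ t in Icc 0 Real.pi, expKernel τ x t * G t
    have hG₁ : ∀ t, ‖g₁ t‖ₑ ≤ G t := fun t => le_self_add
    have hG₂ : ∀ t, ‖g₂ t‖ₑ ≤ G t := fun t => le_add_self
    have hk0 : ∀ (z : ℂ) (t : ℝ), z.re ≤ -τ * |x - t| →
        ‖Complex.exp z‖ₑ ≤ expKernel τ x t := fun z t hz => by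
      rw [enorm_cexp]
      exact (ENNReal.ofReal_le_ofReal (Real.exp_le_exp.2 hz)).trans
        (le_self_add.trans le_self_add)
    have hk1 : ∀ (z : ℂ) (t : ℝ), z.re ≤ -τ * |x - t + Real.pi| →
        ‖Complex.exp z‖ₑ ≤ expKernel τ x t := fun z t hz => by
      rw [enorm_cexp]
      exact (ENNReal.ofReal_le_ofReal (Real.exp_le_exp.2 hz)).trans
        (le_add_self.trans le_self_add)
    have hk2 : ∀ (z : ℂ) (t : ℝ), z.re ≤ -τ * |x - t - Real.pi| →
        ‖Complex.exp z‖ₑ ≤ expKernel τ x t := fun z t hz => by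
      rw [enorm_cexp]
      exact (ENNReal.ofReal_le_ofReal (Real.exp_le_exp.2 hz)).trans le_add_self
    set e₁ : ℂ := Complex.exp (-s * (x - (0 : ℝ)))
    set e₂ : ℂ := Complex.exp (s * (x - Real.pi))
    have habs : ∀ {u v : ℝ}, v ≤ u → -v ≤ u → -τ * u ≤ -τ * |v| := fun h1 h2 => by
      rw [neg_mul, neg_mul, neg_le_neg_iff]
      exact mul_le_mul_of_nonneg_left (abs_le'.2 ⟨h1, h2⟩) hτ.le
    have i₁ : ‖∫ t in (0 : ℝ)..x, Complex.exp (-s * (x - t)) * g₁ t‖ₑ ≤ N := by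
      rw [← one_mul (∫ t in (0 : ℝ)..x, _)]
      refine enorm_mul_intervalIntegral_le h0 hx (fun t ht => ?_) hG₁
      rw [uIcc_of_le hx.1] at ht
      rw [one_mul]
      refine hk0 _ _ (le_trans (le_of_eq ?_) (habs (u := x - t) le_rfl (by linarith [ht.2])))
      simp [τ]
    have i₂ : ‖∫ t in Real.pi..x, Complex.exp (s * (x - t)) * g₂ t‖ₑ ≤ N := by
      rw [← one_mul (∫ t in Real.pi..x, _)]
      refine enorm_mul_intervalIntegral_le hπ hx (fun t ht => ?_) hG₂
      rw [uIcc_of_ge hx.2] at ht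
      rw [one_mul]
      refine hk0 _ _ (le_trans (le_of_eq ?_) (habs (u := t - x) (by linarith [ht.1]) (by linarith)))
      simp [τ]
      ring
    -- Boundary terms. Two of them have the exponents `x - t + π` and `π - x + t`, which produce the
    -- shifted parts of `expKernel`. In the other two, `x + t` and `2π - x - t` both dominate `|x -
    -- t|`.
    have i₃ : ‖e₁ * a‖ₑ ≤ N := by
      refine enorm_mul_intervalIntegral_le h0 hπ (fun t ht => ?_) hG₁
      rw [hu] at ht
      rw [← Complex.exp_add]
      refine hk1 _ _ (le_trans (le_of_eq ?_) (habs (u := x - t + Real.pi) le_rfl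
        (by linarith [ht.2, hx.1])))
      simp [τ]
      ring
    have i₄ : ‖e₁ * b‖ₑ ≤ N := by
      refine enorm_mul_intervalIntegral_le hπ h0 (fun t ht => ?_) hG₂
      rw [uIcc_comm, hu] at ht
      rw [← Complex.exp_add]
      refine hk0 _ _ (le_trans (le_of_eq ?_) (habs (u := x + t)
        (by linarith [ht.1]) (by linarith [hx.1])))
      simp [τ]
      ring
    have i₅ : ‖e₂ * a‖ₑ ≤ N := by
      refine enorm_mul_intervalIntegral_le h0 hπ (fun t ht => ?_) hG₁
      rw [hu] at ht
      rw [← Complex.exp_add]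
      refine hk0 _ _ (le_trans (le_of_eq ?_) (habs (u := (Real.pi - x) + (Real.pi - t))
        (by linarith [hx.2]) (by linarith [ht.2])))
      simp [τ]
      ring
    have i₆ : ‖e₂ * b‖ₑ ≤ N := by
      refine enorm_mul_intervalIntegral_le hπ h0 (fun t ht => ?_) hG₂
      rw [uIcc_comm, hu] at ht
      rw [← Complex.exp_add]
      refine hk2 _ _ (le_trans (le_of_eq ?_) (habs (u := Real.pi - x + t)
        (by linarith [ht.1, hx.2]) (by linarith)))
      simp [τ]
      ring
    have hmul : ∀ e c : ℂ, ‖c‖ ≤ K * (‖a‖ + ‖b‖) → ‖e * a‖ₑ ≤ N → ‖e * b‖ₑ ≤ N →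
        ‖e * c‖ₑ ≤ 2 * ENNReal.ofReal K * N := by
      intro e c hc ha hb
      have hc' : ‖c‖ₑ ≤ ENNReal.ofReal K * (‖a‖ₑ + ‖b‖ₑ) := by
        rw [← ofReal_norm, ← ofReal_norm, ← ofReal_norm,
          ← ENNReal.ofReal_add (norm_nonneg _) (norm_nonneg _), ← ENNReal.ofReal_mul hK0]
        exact ENNReal.ofReal_le_ofReal hc
      calc ‖e * c‖ₑ ≤ ‖e‖ₑ * (ENNReal.ofReal K * (‖a‖ₑ + ‖b‖ₑ)) := by
            rw [enorm_mul]; gcongr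
        _ = ENNReal.ofReal K * (‖e * a‖ₑ + ‖e * b‖ₑ) := by
            rw [enorm_mul, enorm_mul]; ring
        _ ≤ ENNReal.ofReal K * (N + N) := by gcongr
        _ = _ := by ring
    rw [r₁ w₁ hw.ac₁ hw.deriv₁ x hx, r₂ w₂ hw.ac₂ hw.deriv₂ x hx]
    calc _ ≤ (‖e₁ * w₁ 0‖ₑ + N) + (‖e₂ * w₂ Real.pi‖ₑ + N) :=
          add_le_add ((enorm_add_le _ _).trans (by gcongr)) ((enorm_add_le _ _).trans (by gcongr))
      _ ≤ (2 * ENNReal.ofReal K * N + N) + (2 * ENNReal.ofReal K * N + N) := by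
          gcongr
          · exact hmul _ _ hc₁ i₃ i₄
          · exact hmul _ _ hc₂ i₅ i₆
      _ = _ := by ring

end Green

end Dirac

end

noncomputable section

namespace Dirac

/-! ### Diagonalising the unperturbed Dirac system -/

section Solution

open scoped ENNReal

/-- `y` is an absolutely continuous solution of `-B y' = lam y + h` with boundary conditions
`U(y) = 0`. -/
structure IsSolution (U : Matrix (Fin 2) (Fin 4) ℂ) (lam : ℂ)
    (h y : ℝ → EuclideanSpace ℂ (Fin 2)) : Prop where
  ac : AbsolutelyContinuousOnInterval y 0 Real.pi
  bc : boundaryForm U y = 0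
  deriv : ∀ᵐ x, x ∈ Icc 0 Real.pi →
    HasDerivAt y (!₂[lam * y x 1 + h x 1, -(lam * y x 0 + h x 0)]) x

theorem boundaryForm_apply (U : Matrix (Fin 2) (Fin 4) ℂ) (y : ℝ → EuclideanSpace ℂ (Fin 2))
    (i : Fin 2) : boundaryForm U y i =
      U i 0 * y 0 0 + U i 1 * y 0 1 + U i 2 * y Real.pi 0 + U i 3 * y Real.pi 1 := by
  simp [boundaryForm, Matrix.mulVec, dotProduct, Fin.sum_univ_four]

theorem enorm_apply_le (v : EuclideanSpace ℂ (Fin 2)) (i : Fin 2) : ‖v i‖ₑ ≤ ‖v‖ₑ := by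
  rw [enorm_le_iff_norm_le]
  exact PiLp.norm_apply_le v i

theorem enorm_le_add (v : EuclideanSpace ℂ (Fin 2)) : ‖v‖ₑ ≤ ‖v 0‖ₑ + ‖v 1‖ₑ := by
  have e : v = EuclideanSpace.single 0 (v 0) + EuclideanSpace.single 1 (v 1) := by
    ext i
    fin_cases i <;> simp
  calc ‖v‖ₑ ≤ ‖EuclideanSpace.single (0 : Fin 2) (v 0)‖ₑ +
        ‖EuclideanSpace.single (1 : Fin 2) (v 1)‖ₑ := by
        nth_rewrite 1 [e]
        exact enorm_add_le _ _
    _ = _ := by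
        rw [← ofReal_norm, ← ofReal_norm, PiLp.norm_single, PiLp.norm_single,
          ofReal_norm, ofReal_norm]

/-- The projection on the `i`-th coordinate, as a real-linear map. -/
def coordCLM (i : Fin 2) : EuclideanSpace ℂ (Fin 2) →L[ℝ] ℂ :=
  (EuclideanSpace.proj i : EuclideanSpace ℂ (Fin 2) →L[ℂ] ℂ).restrictScalars ℝ

theorem absolutelyContinuousOnInterval_apply {y : ℝ → EuclideanSpace ℂ (Fin 2)} {a b : ℝ}
    (hy : AbsolutelyContinuousOnInterval y a b) (i : Fin 2) :
    AbsolutelyContinuousOnInterval (fun x => y x i) a b := by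
  refine absolutelyContinuousOnInterval_of_dist_le hy fun u _ v _ => ?_
  rw [dist_eq_norm, dist_eq_norm]
  exact PiLp.norm_apply_le (y u - y v) i

theorem absolutelyContinuousOnInterval_vec {u v : ℝ → ℂ} {a b : ℝ}
    (hu : AbsolutelyContinuousOnInterval u a b) (hv : AbsolutelyContinuousOnInterval v a b) :
    AbsolutelyContinuousOnInterval (fun x => (!₂[u x, v x] : EuclideanSpace ℂ (Fin 2))) a b := by
  have h : ∀ (i : Fin 2) (w : ℝ → ℂ), AbsolutelyContinuousOnInterval w a b →
      AbsolutelyContinuousOnInterval (fun x => EuclideanSpace.single i (w x)) a b :=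
    fun i w hw => absolutelyContinuousOnInterval_of_dist_le hw fun s _ t _ => by simp
  have h2 := (h 0 u hu).add (h 1 v hv)
  have e : (fun x => (!₂[u x, v x] : EuclideanSpace ℂ (Fin 2))) =
      (fun x => EuclideanSpace.single 0 (u x)) + fun x => EuclideanSpace.single 1 (v x) := by
    funext x
    ext i
    fin_cases i <;> simp
  rw [e]
  exact h2

theorem hasDerivAt_vec {u v : ℝ → ℂ} {u' v' : ℂ} {x : ℝ} (hu : HasDerivAt u u' x)
    (hv : HasDerivAt v v' x) :
    HasDerivAt (fun x => (!₂[u x, v x] : EuclideanSpace ℂ (Fin 2))) !₂[u', v'] x := by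
  have h : HasDerivAt (fun x => ![u x, v x]) ![u', v'] x := by
    rw [hasDerivAt_pi]
    intro i
    fin_cases i
    · exact hu
    · exact hv
  exact (PiLp.continuousLinearEquiv 2 ℝ (fun _ : Fin 2 => ℂ)).symm.hasFDerivAt.comp_hasDerivAt x h

theorem hasDerivAt_apply {y : ℝ → EuclideanSpace ℂ (Fin 2)} {y' : EuclideanSpace ℂ (Fin 2)}
    {x : ℝ} (hy : HasDerivAt y y' x) (i : Fin 2) : HasDerivAt (fun x => y x i) (y' i) x :=
  (coordCLM i).hasFDerivAt.comp_hasDerivAt x hy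

variable {U : Matrix (Fin 2) (Fin 4) ℂ}

/-- The bound for the Green function in one half-plane, `j = ± i`. -/
theorem exists_green_bound_half {j : ℂ} (hj : j * j = -1)
    (hdet : J U 1 4 + J U 3 2 - j * (J U 4 2 - J U 1 3) ≠ 0) :
    ∃ C : ℝ≥0∞, C ≠ ∞ ∧ ∃ τ₀ > 0, ∀ lam : ℂ, τ₀ ≤ (-j * lam).re →
      ∀ h : ℝ → EuclideanSpace ℂ (Fin 2), IntegrableOn h (Icc 0 Real.pi) →
      (∃ y, IsSolution U lam h y) ∧ ∀ y, IsSolution U lam h y → ∀ x ∈ Icc 0 Real.pi,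
        ‖y x‖ₑ ≤ C * ∫⁻ t in Icc 0 Real.pi, expKernel (-j * lam).re x t * ‖h t‖ₑ := by
  have hpi := Real.pi_pos
  have hu : uIcc 0 Real.pi = Icc 0 Real.pi := uIcc_of_le hpi.le
  have hj1 : ‖j‖ = 1 := by
    have := congrArg norm hj
    rw [norm_mul, norm_neg, norm_one] at this
    nlinarith [norm_nonneg j]
  have hje : ‖j‖ₑ = 1 := by rw [← ofReal_norm, hj1, ENNReal.ofReal_one]
  have hj0 : j ≠ 0 := by rintro rfl; simp at hj1
  -- The `p`'s are the columns of `U` rewritten for `w₁ = y₁ - j y₂`, `w₂ = y₁ + j y₂`, that is, `y₁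
  -- = (w₁ + w₂) / 2` and `y₂ = j (w₁ - w₂) / 2`. The minor of `p₁`, `p₄` is `-j / 4` times the
  -- number assumed nonzero.
  obtain ⟨C, hC, τ₀, hτ₀, H⟩ := exists_diagonal_green_bound
    (p₁ := fun i => (U i 0 + j * U i 1) / 2) (p₂ := fun i => (U i 0 - j * U i 1) / 2)
    (p₃ := fun i => (U i 2 + j * U i 3) / 2) (p₄ := fun i => (U i 2 - j * U i 3) / 2) (by
      intro h0
      refine hdet ((mul_eq_zero.1 (?_ : (-j / 4) * _ = 0)).resolve_left
        (div_ne_zero (neg_ne_zero.2 hj0) (by norm_num)))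
      rw [← h0]
      simp only [J, Matrix.det_fin_two, Matrix.submatrix_apply, id]
      change (-j / 4) * ((U 0 0 * U 1 3 - U 0 3 * U 1 0) + (U 0 2 * U 1 1 - U 0 1 * U 1 2) -
        j * ((U 0 3 * U 1 1 - U 0 1 * U 1 3) - (U 0 0 * U 1 2 - U 0 2 * U 1 0))) = _
      linear_combination (((U 0 3 * U 1 1 - U 0 1 * U 1 3) -
        (U 0 0 * U 1 2 - U 0 2 * U 1 0)) / 4 - (U 0 3 * U 1 1 - U 0 1 * U 1 3) / 4) * hj)
  refine ⟨C * 4, by finiteness, τ₀, hτ₀, fun lam hlam h hh => ?_⟩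
  have hcoord : ∀ i, IntervalIntegrable (fun x => h x i) volume 0 Real.pi := fun i => by
    rw [intervalIntegrable_iff_integrableOn_Icc_of_le hpi.le]
    exact (coordCLM i).integrable_comp hh
  set g₁ : ℝ → ℂ := fun x => j * (h x 0 - j * h x 1)
  set g₂ : ℝ → ℂ := fun x => -(j * (h x 0 + j * h x 1))
  have hg₁ : IntervalIntegrable g₁ volume 0 Real.pi :=
    ((hcoord 0).sub ((hcoord 1).const_mul j)).const_mul j
  have hg₂ : IntervalIntegrable g₂ volume 0 Real.pi :=
    (((hcoord 0).add ((hcoord 1).const_mul j)).const_mul j).neg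
  obtain ⟨⟨w₁, w₂, hw⟩, hb⟩ := H (-j * lam) hlam g₁ g₂ hg₁ hg₂
  constructor
  · refine ⟨fun x => !₂[(w₁ x + w₂ x) / 2, j * (w₁ x - w₂ x) / 2], ?_, ?_, ?_⟩
    · have h1 := (hw.ac₁.add hw.ac₂).const_smul (1 / 2 : ℂ)
      have h2 := (hw.ac₁.sub hw.ac₂).const_smul (j / 2)
      convert absolutelyContinuousOnInterval_vec h1 h2 using 5 with x
      · simp only [Pi.add_apply, smul_eq_mul]
        ring
      · simp only [Pi.sub_apply, smul_eq_mul]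
        ring_nf
    · ext i
      rw [boundaryForm_apply]
      simp only [Matrix.cons_val_zero, Matrix.cons_val_one, Pi.zero_apply]
      linear_combination hw.bc i
    · filter_upwards [hw.deriv₁, hw.deriv₂] with x h1 h2 hx
      have d1 := h1 (hu ▸ hx)
      have d2 := h2 (hu ▸ hx)
      have d3 := hasDerivAt_vec ((d1.add d2).div_const 2) (((d1.sub d2).const_mul j).div_const 2)
      refine d3.congr_deriv ?_
      simp only [Matrix.cons_val_zero, Matrix.cons_val_one, g₁, g₂]
      congr 2
      · linear_combination (-(h x 1)) * hj
      · congr 1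
        linear_combination (lam * (w₁ x + w₂ x) / 2 + h x 0) * hj
  · intro y hy x hx
    have hd0 : IsDiagonalSolution (fun i => (U i 0 + j * U i 1) / 2)
        (fun i => (U i 0 - j * U i 1) / 2) (fun i => (U i 2 + j * U i 3) / 2)
        (fun i => (U i 2 - j * U i 3) / 2) (-j * lam) g₁ g₂
        (fun x => y x 0 - j * y x 1) (fun x => y x 0 + j * y x 1) := by
      have a0 := absolutelyContinuousOnInterval_apply hy.ac 0
      have a1 := (absolutelyContinuousOnInterval_apply hy.ac 1).const_smul j
      refine ⟨a0.sub a1, a0.add a1, ?_, ?_, fun i => ?_⟩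
      · filter_upwards [hy.deriv] with t ht hu'
        have d := ht (hu ▸ hu')
        refine ((hasDerivAt_apply d 0).sub ((hasDerivAt_apply d 1).const_mul j)).congr_deriv ?_
        simp only [Matrix.cons_val_zero, Matrix.cons_val_one, g₁]
        linear_combination (lam * y t 1 + h t 1) * hj
      · filter_upwards [hy.deriv] with t ht hu'
        have d := ht (hu ▸ hu')
        refine ((hasDerivAt_apply d 0).add ((hasDerivAt_apply d 1).const_mul j)).congr_deriv ?_
        simp only [Matrix.cons_val_zero, Matrix.cons_val_one, g₂]
        linear_combination (lam * y t 1 + h t 1) * hj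
      · have := congrFun hy.bc i
        rw [boundaryForm_apply] at this
        simp only [Pi.zero_apply] at this
        linear_combination this - (U i 1 * y 0 1 + U i 3 * y Real.pi 1) * hj
    have hyw : ‖y x‖ₑ ≤ ‖y x 0 - j * y x 1‖ₑ + ‖y x 0 + j * y x 1‖ₑ := by
      rw [← ofReal_norm, ← ofReal_norm, ← ofReal_norm,
        ← ENNReal.ofReal_add (norm_nonneg _) (norm_nonneg _)]
      refine ENNReal.ofReal_le_ofReal ?_
      set u := y x 0 - j * y x 1 with hu_def
      set v := y x 0 + j * y x 1 with hv_def
      have e0 : y x 0 = (u + v) / 2 := by rw [hu_def, hv_def]; ring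
      have e1 : y x 1 = j * (u - v) / 2 := by
        rw [hu_def, hv_def]; linear_combination (y x 1) * hj
      have n0 : ‖y x 0‖ ≤ (‖u‖ + ‖v‖) / 2 := by
        rw [e0, norm_div]
        simpa using div_le_div_of_nonneg_right (norm_add_le u v) two_pos.le
      have n1 : ‖y x 1‖ ≤ (‖u‖ + ‖v‖) / 2 := by
        rw [e1, norm_div, norm_mul, hj1, one_mul]
        simpa using div_le_div_of_nonneg_right (norm_sub_le u v) two_pos.le
      have n2 : ‖y x‖ ≤ ‖y x 0‖ + ‖y x 1‖ := by
        have := enorm_le_add (y x)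
        rw [← ofReal_norm, ← ofReal_norm, ← ofReal_norm,
          ← ENNReal.ofReal_add (norm_nonneg _) (norm_nonneg _)] at this
        exact (ENNReal.ofReal_le_ofReal_iff (by positivity)).1 this
      linarith
    have hg : ∀ t, ‖g₁ t‖ₑ + ‖g₂ t‖ₑ ≤ 4 * ‖h t‖ₑ := by
      intro t
      have m1 : ‖g₁ t‖ₑ ≤ ‖h t‖ₑ + ‖h t‖ₑ := by
        simp only [g₁]
        rw [enorm_mul, hje, one_mul]
        refine enorm_sub_le.trans ?_
        rw [enorm_mul, hje, one_mul]
        exact add_le_add (enorm_apply_le _ _) (enorm_apply_le _ _)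
      have m2 : ‖g₂ t‖ₑ ≤ ‖h t‖ₑ + ‖h t‖ₑ := by
        simp only [g₂]
        rw [enorm_neg, enorm_mul, hje, one_mul]
        refine (enorm_add_le _ _).trans ?_
        rw [enorm_mul, hje, one_mul]
        exact add_le_add (enorm_apply_le _ _) (enorm_apply_le _ _)
      calc _ ≤ (‖h t‖ₑ + ‖h t‖ₑ) + (‖h t‖ₑ + ‖h t‖ₑ) := add_le_add m1 m2
        _ = _ := by ring
    calc ‖y x‖ₑ ≤ _ := hyw
      _ ≤ C * ∫⁻ t in Icc 0 Real.pi, expKernel (-j * lam).re x t * (‖g₁ t‖ₑ + ‖g₂ t‖ₑ) :=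
          hb _ _ hd0 x hx
      _ ≤ C * ∫⁻ t in Icc 0 Real.pi, 4 * (expKernel (-j * lam).re x t * ‖h t‖ₑ) := by
          gcongr 1
          refine lintegral_mono fun t => ?_
          rw [mul_left_comm]
          exact mul_le_mul_right (hg t) _
      _ = _ := by
          rw [lintegral_const_mul' _ _ (by norm_num), mul_assoc]

/-- The Green function of the unperturbed operator exists in the two half-planes
`|Im lam| ≥ τ₀` and is dominated by `expKernel`. -/
theorem exists_green_bound (hU : IsRegular U) :
    ∃ C : ℝ≥0∞, C ≠ ∞ ∧ ∃ τ₀ > 0, ∀ lam : ℂ, τ₀ ≤ |lam.im| →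
      ∀ h : ℝ → EuclideanSpace ℂ (Fin 2), IntegrableOn h (Icc 0 Real.pi) →
      (∃ y, IsSolution U lam h y) ∧ ∀ y, IsSolution U lam h y → ∀ x ∈ Icc 0 Real.pi,
        ‖y x‖ₑ ≤ C * ∫⁻ t in Icc 0 Real.pi, expKernel |lam.im| x t * ‖h t‖ₑ := by
  obtain ⟨C₁, hC₁, τ₁, hτ₁, H₁⟩ := exists_green_bound_half (U := U) (j := Complex.I)
    Complex.I_mul_I hU.2
  obtain ⟨C₂, hC₂, τ₂, hτ₂, H₂⟩ := exists_green_bound_half (U := U) (j := -Complex.I)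
    (by simp) (by rw [neg_mul, sub_neg_eq_add]; exact hU.1)
  refine ⟨C₁ + C₂, by finiteness, max τ₁ τ₂, by positivity, fun lam hlam h hh => ?_⟩
  -- `Re (-j lam)` is `Im lam` for `j = i` and `-Im lam` for `j = -i`.
  rcases le_total 0 lam.im with hs | hs
  · have e : (-Complex.I * lam).re = |lam.im| := by simp [abs_of_nonneg hs]
    obtain ⟨h1, h2⟩ := H₁ lam (by rw [e]; exact (le_max_left _ _).trans hlam) h hh
    refine ⟨h1, fun y hy x hx => (h2 y hy x hx).trans ?_⟩
    rw [e]
    gcongr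
    exact le_self_add
  · have e : (-(-Complex.I) * lam).re = |lam.im| := by simp [abs_of_nonpos hs]
    obtain ⟨h1, h2⟩ := H₂ lam (by rw [e]; exact (le_max_right _ _).trans hlam) h hh
    refine ⟨h1, fun y hy x hx => (h2 y hy x hx).trans ?_⟩
    rw [e]
    gcongr
    exact le_add_self

end Solution

end Dirac

end

noncomputable section

namespace Dirac

/-! ### Adding an integrable potential -/

section Perturbation

open scoped ENNReal

variable {Q : ℝ → Matrix (Fin 2) (Fin 2) ℂ} {U : Matrix (Fin 2) (Fin 4) ℂ}

theorem toEuclideanLin_apply_fin_two (M : Matrix (Fin 2) (Fin 2) ℂ) (v : EuclideanSpace ℂ (Fin 2))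
    (i : Fin 2) : M.toEuclideanLin v i = M i 0 * v 0 + M i 1 * v 1 := by
  fin_cases i <;> simp [Matrix.toLpLin_apply]

/-- The sum of the absolute values of the entries of the potential. -/
def potentialNorm (Q : ℝ → Matrix (Fin 2) (Fin 2) ℂ) (t : ℝ) : ℝ≥0∞ :=
  ∑ i, ∑ j, ‖Q t i j‖ₑ

theorem enorm_toEuclideanLin_le (Q : ℝ → Matrix (Fin 2) (Fin 2) ℂ) (t : ℝ)
    (v : EuclideanSpace ℂ (Fin 2)) :
    ‖(Q t).toEuclideanLin v‖ₑ ≤ potentialNorm Q t * ‖v‖ₑ := by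
  have h : ∀ i, ‖(Q t).toEuclideanLin v i‖ₑ ≤ (∑ j, ‖Q t i j‖ₑ) * ‖v‖ₑ := fun i => by
    rw [toEuclideanLin_apply_fin_two, Fin.sum_univ_two, add_mul]
    refine (enorm_add_le _ _).trans ?_
    rw [enorm_mul, enorm_mul]
    gcongr <;> exact enorm_apply_le v _
  refine (enorm_le_add _).trans ?_
  rw [potentialNorm, Fin.sum_univ_two, add_mul]
  exact add_le_add (h 0) (h 1)

theorem aemeasurable_potentialNorm
    (hQ : ∀ i j, IntegrableOn (fun x => Q x i j) (Icc (0 : ℝ) Real.pi) volume) :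
    AEMeasurable (potentialNorm Q) (volume.restrict (Icc (0 : ℝ) Real.pi)) :=
  Finset.aemeasurable_fun_sum _ fun i _ => Finset.aemeasurable_fun_sum _ fun j _ =>
    (hQ i j).aestronglyMeasurable.enorm

theorem lintegral_potentialNorm_ne_top
    (hQ : ∀ i j, IntegrableOn (fun x => Q x i j) (Icc (0 : ℝ) Real.pi) volume) :
    ∫⁻ t in Icc (0 : ℝ) Real.pi, potentialNorm Q t ≠ ∞ := by
  unfold potentialNorm
  rw [lintegral_finsetSum' _ fun i _ => Finset.aemeasurable_fun_sum _ fun j _ =>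
    (hQ i j).aestronglyMeasurable.enorm]
  refine ENNReal.sum_ne_top.2 fun i _ => ?_
  rw [lintegral_finsetSum' _ fun j _ => (hQ i j).aestronglyMeasurable.enorm]
  exact ENNReal.sum_ne_top.2 fun j _ => (hQ i j).hasFiniteIntegral.ne

theorem integrableOn_toEuclideanLin
    (hQ : ∀ i j, IntegrableOn (fun x => Q x i j) (Icc (0 : ℝ) Real.pi) volume)
    {y : ℝ → EuclideanSpace ℂ (Fin 2)} (hy : ContinuousOn y (Icc 0 Real.pi)) :
    IntegrableOn (fun t => (Q t).toEuclideanLin (y t)) (Icc 0 Real.pi) := by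
  have hc : ∀ i, ContinuousOn (fun t => y t i) (Icc 0 Real.pi) := fun i =>
    (coordCLM i).continuous.comp_continuousOn hy
  have hi : ∀ i, IntegrableOn (fun t => (Q t).toEuclideanLin (y t) i) (Icc 0 Real.pi) := fun i => by
    simp only [toEuclideanLin_apply_fin_two]
    exact ((hQ i 0).mul_continuousOn (hc 0) isCompact_Icc).add
      ((hQ i 1).mul_continuousOn (hc 1) isCompact_Icc)
  exact Integrable.of_eval_piLp hi

theorem IsSolution.sub {lam : ℂ} {h₁ h₂ y₁ y₂ : ℝ → EuclideanSpace ℂ (Fin 2)}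
    (H₁ : IsSolution U lam h₁ y₁) (H₂ : IsSolution U lam h₂ y₂) :
    IsSolution U lam (fun t => h₁ t - h₂ t) (fun t => y₁ t - y₂ t) where
  ac := H₁.ac.sub H₂.ac
  bc := by
    ext i
    have e₁ := congrFun H₁.bc i
    have e₂ := congrFun H₂.bc i
    rw [boundaryForm_apply] at e₁ e₂ ⊢
    simp only [Pi.zero_apply, PiLp.sub_apply] at e₁ e₂ ⊢
    linear_combination e₁ - e₂
  deriv := by
    filter_upwards [H₁.deriv, H₂.deriv] with x d₁ d₂ hx
    refine ((d₁ hx).sub (d₂ hx)).congr_deriv ?_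
    ext i
    fin_cases i <;> simp <;> ring

theorem IsSolution.congr {lam : ℂ} {h₁ h₂ y : ℝ → EuclideanSpace ℂ (Fin 2)}
    (H : IsSolution U lam h₁ y) (h : ∀ᵐ t, t ∈ Icc 0 Real.pi → h₁ t = h₂ t) :
    IsSolution U lam h₂ y where
  ac := H.ac
  bc := H.bc
  deriv := by
    filter_upwards [H.deriv, h] with x d e hx
    rw [← e hx]
    exact d hx

theorem IsSolution.continuousOn {lam : ℂ} {h y : ℝ → EuclideanSpace ℂ (Fin 2)}
    (H : IsSolution U lam h y) : ContinuousOn y (Icc 0 Real.pi) := by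
  have := H.ac.continuousOn
  rwa [uIcc_of_le Real.pi_pos.le] at this

/-- For large `|Im z|` the equation `l_Q(y) - z y = F` with boundary conditions is uniquely
solvable, with bounds for the uniform and the `L₂` norms of the solution. -/
theorem exists_solution_bound (hU : IsRegular U)
    (hQ : ∀ i j, IntegrableOn (fun x => Q x i j) (Icc (0 : ℝ) Real.pi) volume) :
    ∃ C : ℝ≥0∞, C ≠ ∞ ∧ ∃ τ₀ > 0, ∀ z : ℂ, τ₀ ≤ |z.im| →
      ∀ F : ℝ → EuclideanSpace ℂ (Fin 2), MemLp F 2 (volume.restrict (Icc 0 Real.pi)) →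
      (∃ y, IsSolution U z (fun t => F t - (Q t).toEuclideanLin (y t)) y) ∧
      ∀ y, IsSolution U z (fun t => F t - (Q t).toEuclideanLin (y t)) y →
        (∀ x ∈ Icc 0 Real.pi, ‖y x‖ₑ ^ 2 ≤
          C * ENNReal.ofReal |z.im|⁻¹ * ∫⁻ t in Icc 0 Real.pi, ‖F t‖ₑ ^ 2) ∧
        ∫⁻ x in Icc 0 Real.pi, ‖y x‖ₑ ^ 2 ≤
          C * ENNReal.ofReal |z.im|⁻¹ ^ 2 * ∫⁻ t in Icc 0 Real.pi, ‖F t‖ₑ ^ 2 := by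
  obtain ⟨C₀, hC₀, τ₁, hτ₁, H⟩ := exists_green_bound hU
  set q := potentialNorm Q
  have hqm := aemeasurable_potentialNorm hQ
  have hqf := lintegral_potentialNorm_ne_top hQ
  set q₁ := ∫⁻ t in Icc (0 : ℝ) Real.pi, q t
  -- Enlarged to be nonzero, hence invertible. The threshold `(2 * C₁)⁻¹` for the kernel applied to
  -- `q` then makes the perturbation of norm at most `1/2` in the uniform norm.
  set C₁ := C₀ + 1
  have hC₁ : C₁ ≠ ∞ := by finiteness
  have hC₁0 : C₁ ≠ 0 := by simp [C₁]
  have hε : (0 : ℝ≥0∞) < (2 * C₁)⁻¹ := ENNReal.inv_pos.2 (by finiteness)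
  have hε1 : (2 * C₁)⁻¹ ≤ 1 := by
    rw [ENNReal.inv_le_one]
    calc (1 : ℝ≥0∞) ≤ C₁ := le_add_self
      _ ≤ 2 * C₁ := by rw [two_mul]; exact le_self_add
  have hεC : C₁ * (2 * C₁)⁻¹ = 2⁻¹ := by
    rw [ENNReal.mul_inv (by simp) (by simp), mul_left_comm, ENNReal.mul_inv_cancel hC₁0 hC₁, mul_one]
  obtain ⟨τ₂, hτ₂, Hq⟩ := exists_lintegral_expKernel_mul_le hqm hqf hε
  refine ⟨72 * C₁ ^ 2 + 864 * C₁ ^ 4 * q₁, by finiteness, max τ₁ τ₂, by positivity, ?_⟩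
  intro z hz F hF
  set τ := |z.im|
  have hτ : 0 < τ := lt_of_lt_of_le (by positivity) hz
  have hFi : IntegrableOn F (Icc 0 Real.pi) := hF.integrable (by norm_num)
  have hFm : AEMeasurable (fun t => ‖F t‖ₑ) (volume.restrict (Icc 0 Real.pi)) :=
    hF.1.enorm
  have hqs : ∀ x, ∫⁻ t in Icc 0 Real.pi, expKernel τ x t * q t ≤ (2 * C₁)⁻¹ :=
    fun x => Hq τ ((le_max_right _ _).trans hz) x
  have Hex := fun h hh => (H z ((le_max_left _ _).trans hz) h hh).1
  have Hbd : ∀ h, IntegrableOn h (Icc 0 Real.pi) → ∀ y, IsSolution U z h y →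
      ∀ x ∈ Icc 0 Real.pi, ‖y x‖ₑ ≤ C₁ * ∫⁻ t in Icc 0 Real.pi, expKernel τ x t * ‖h t‖ₑ :=
    fun h hh y hy x hx => ((H z ((le_max_left _ _).trans hz) h hh).2 y hy x hx).trans (by
      gcongr
      exact le_self_add)
  constructor
  -- Existence by Banach's theorem: `N v` is a solution of the unperturbed problem with right-hand
  -- side `F - Q v`, where `v` is extended to the line by constants.
  · let X := C(Icc (0 : ℝ) Real.pi, EuclideanSpace ℂ (Fin 2))
    let e : X → ℝ → EuclideanSpace ℂ (Fin 2) := fun v t => v (projIcc 0 Real.pi Real.pi_pos.le t)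
    have he : ∀ v, Continuous (e v) := fun v => v.continuous.comp continuous_projIcc
    have hint : ∀ v, IntegrableOn (fun t => F t - (Q t).toEuclideanLin (e v t)) (Icc 0 Real.pi) :=
      fun v => hFi.sub (integrableOn_toEuclideanLin hQ (he v).continuousOn)
    choose y hy using fun v => Hex _ (hint v)
    let N : X → X := fun v => ⟨fun x => y v x, (hy v).continuousOn.comp_continuous
      continuous_subtype_val fun x => x.2⟩
    have hN : ContractingWith (1 / 2) N := by
      refine ⟨by norm_num [← NNReal.coe_lt_coe], LipschitzWith.of_dist_le_mul fun v w => ?_⟩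
      rw [ContinuousMap.dist_le (by positivity)]
      intro x
      have h1 := Hbd _ ((hint v).sub (hint w)) _ ((hy v).sub (hy w)) x x.2
      have h2 : ∀ t, ‖(F t - (Q t).toEuclideanLin (e v t)) -
          (F t - (Q t).toEuclideanLin (e w t))‖ₑ ≤ q t * ENNReal.ofReal (dist v w) := fun t => by
        have e1 : (F t - (Q t).toEuclideanLin (e v t)) - (F t - (Q t).toEuclideanLin (e w t)) =
            (Q t).toEuclideanLin (e w t - e v t) := by rw [map_sub]; abel
        rw [e1]
        refine (enorm_toEuclideanLin_le Q t _).trans ?_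
        gcongr
        rw [← ofReal_norm, ← dist_eq_norm, dist_comm]
        exact ENNReal.ofReal_le_ofReal (ContinuousMap.dist_apply_le_dist _)
      have h3 : ‖y v x - y w x‖ₑ ≤ ENNReal.ofReal (1 / 2 * dist v w) := by
        calc ‖y v x - y w x‖ₑ ≤ _ := h1
          _ ≤ C₁ * ∫⁻ t in Icc 0 Real.pi, expKernel τ x t * q t * ENNReal.ofReal (dist v w) := by
              gcongr 1
              refine lintegral_mono fun t => ?_
              rw [mul_assoc]
              exact mul_le_mul_right (h2 t) _
          _ = C₁ * (∫⁻ t in Icc 0 Real.pi, expKernel τ x t * q t) * ENNReal.ofReal (dist v w) := by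
              rw [lintegral_mul_const' _ _ (by finiteness), mul_assoc]
          _ ≤ C₁ * (2 * C₁)⁻¹ * ENNReal.ofReal (dist v w) := by
              gcongr
              exact hqs x
          _ = _ := by
              rw [hεC, ENNReal.ofReal_mul (by norm_num)]
              congr 1
              simp
      rw [← ofReal_norm, ENNReal.ofReal_le_ofReal_iff (by positivity)] at h3
      rw [dist_eq_norm]
      simpa [N] using h3
    refine ⟨y hN.fixedPoint, (hy hN.fixedPoint).congr (Filter.Eventually.of_forall fun t ht => ?_)⟩
    have h1 : N hN.fixedPoint = hN.fixedPoint := hN.fixedPoint_isFixedPt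
    have h2 : y hN.fixedPoint t = e hN.fixedPoint t := by
      have h3 := DFunLike.congr_fun h1 ⟨t, ht⟩
      simp only [e, projIcc_of_mem Real.pi_pos.le ht]
      exact h3
    simp only [h2]
  · intro y hy
    have hyc := hy.continuousOn
    set n := ∫⁻ t in Icc 0 Real.pi, ‖F t‖ₑ ^ 2
    set Y := ⨆ x ∈ Icc 0 Real.pi, ‖y x‖ₑ
    have hYx : ∀ x ∈ Icc 0 Real.pi, ‖y x‖ₑ ≤ Y := fun x hx => le_iSup₂ (f := fun x _ => ‖y x‖ₑ) x hx
    -- Finiteness of the supremum is what permits absorbing `Y / 2` into the left-hand side below.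
    have hYtop : Y ≠ ∞ := by
      obtain ⟨M, hM⟩ := isCompact_Icc.exists_bound_of_continuousOn hyc
      refine ne_top_of_le_ne_top (ENNReal.ofReal_ne_top (r := M)) (iSup₂_le fun x hx => ?_)
      rw [← ofReal_norm]
      exact ENNReal.ofReal_le_ofReal (hM x hx)
    have hpt : ∀ x ∈ Icc 0 Real.pi, ‖y x‖ₑ ≤
        C₁ * ((∫⁻ t in Icc 0 Real.pi, expKernel τ x t * ‖F t‖ₑ) +
          Y * ∫⁻ t in Icc 0 Real.pi, expKernel τ x t * q t) := fun x hx => by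
      refine (Hbd _ (hFi.sub (integrableOn_toEuclideanLin hQ hyc)) y hy x hx).trans ?_
      gcongr 1
      rw [← lintegral_const_mul' _ _ hYtop, ← lintegral_add_left'
        (f := fun t => expKernel τ x t * ‖F t‖ₑ) ((measurable_expKernel_right τ x).aemeasurable.mul hFm)]
      refine setLIntegral_mono' measurableSet_Icc fun t ht => ?_
      calc expKernel τ x t * ‖F t - (Q t).toEuclideanLin (y t)‖ₑ
          ≤ expKernel τ x t * (‖F t‖ₑ + q t * Y) := by
            gcongr
            refine enorm_sub_le.trans ?_
            gcongr
            refine (enorm_toEuclideanLin_le Q t _).trans ?_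
            gcongr
            exact hYx t ht
        _ = _ := by ring
    have h6 : ENNReal.ofReal (6 / τ) = 6 * ENNReal.ofReal τ⁻¹ := by
      rw [div_eq_mul_inv, ENNReal.ofReal_mul (by norm_num)]
      simp
    have h18 : ENNReal.ofReal (18 / τ) = 18 * ENNReal.ofReal τ⁻¹ := by
      rw [div_eq_mul_inv, ENNReal.ofReal_mul (by norm_num)]
      simp
    set u := ENNReal.ofReal τ⁻¹
    have hY : Y ^ 2 ≤ 72 * C₁ ^ 2 * u * n := by
      set S : ℝ≥0∞ := (18 * u * n) ^ (1 / 2 : ℝ)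
      have hS2 : S ^ 2 = 18 * u * n := by
        rw [← ENNReal.rpow_two, ← ENNReal.rpow_mul]
        norm_num
      have hS : ∀ x, ∫⁻ t in Icc 0 Real.pi, expKernel τ x t * ‖F t‖ₑ ≤ S := fun x => by
        have := sq_lintegral_expKernel_mul_le hτ x hFm
        rw [h18, ← hS2] at this
        exact (ENNReal.pow_le_pow_left_iff two_ne_zero).1 this
      have hY1 : Y ≤ C₁ * S + Y / 2 := by
        refine iSup₂_le fun x hx => (hpt x hx).trans ?_
        calc _ ≤ C₁ * (S + Y * (2 * C₁)⁻¹) := by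
              gcongr
              · exact hS x
              · exact hqs x
          _ = C₁ * S + Y * (C₁ * (2 * C₁)⁻¹) := by ring
          _ = _ := by rw [hεC, div_eq_mul_inv]
      have hY2 : Y / 2 ≤ C₁ * S := by
        nth_rewrite 1 [← ENNReal.add_halves Y] at hY1
        exact (ENNReal.add_le_add_iff_right (by finiteness)).1 hY1
      have hY3 : Y ≤ 2 * (C₁ * S) := by
        calc Y = Y / 2 + Y / 2 := (ENNReal.add_halves Y).symm
          _ ≤ C₁ * S + C₁ * S := add_le_add hY2 hY2
          _ = _ := by ring
      calc Y ^ 2 ≤ (2 * (C₁ * S)) ^ 2 := by gcongr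
        _ = 4 * C₁ ^ 2 * S ^ 2 := by ring
        _ = _ := by rw [hS2]; ring
    constructor
    · intro x hx
      calc ‖y x‖ₑ ^ 2 ≤ Y ^ 2 := by gcongr; exact hYx x hx
        _ ≤ 72 * C₁ ^ 2 * u * n := hY
        _ ≤ _ := by gcongr; exact le_self_add
    · have hA : ∫⁻ x in Icc 0 Real.pi, (∫⁻ t in Icc 0 Real.pi, expKernel τ x t * ‖F t‖ₑ) ^ 2 ≤
          (6 * u) * (6 * u) * n := by
        rw [← h6]
        exact lintegral_sq_lintegral_mul_le (measurable_expKernel τ) hFm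
          (Filter.Eventually.of_forall fun x => lintegral_expKernel_le hτ x _)
          (Filter.Eventually.of_forall fun t => by
            simp only [expKernel_comm τ _ t]
            exact lintegral_expKernel_le hτ t _)
      -- One factor of the square is at most `1`; Tonelli and the kernel mass give the rest. This
      -- `τ⁻¹`, combined with the `τ⁻¹` in the bound for `Y ^ 2`, yields the required `τ⁻²`.
      have hB : ∫⁻ x in Icc 0 Real.pi, (∫⁻ t in Icc 0 Real.pi, expKernel τ x t * q t) ^ 2 ≤
          (6 * u) * q₁ := by
        calc _ ≤ ∫⁻ x in Icc 0 Real.pi, ∫⁻ t in Icc 0 Real.pi, expKernel τ x t * q t := by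
              refine lintegral_mono fun x => ?_
              rw [sq]
              exact mul_le_of_le_one_left' ((hqs x).trans hε1)
          _ = ∫⁻ t in Icc 0 Real.pi, ∫⁻ x in Icc 0 Real.pi, expKernel τ x t * q t := by
              rw [lintegral_lintegral_swap]
              exact (measurable_expKernel τ).aemeasurable.mul hqm.comp_snd
          _ ≤ ∫⁻ t in Icc 0 Real.pi, 6 * u * q t := by
              refine lintegral_mono fun t => ?_
              simp only [expKernel_comm τ _ t]
              rw [lintegral_mul_const _ (measurable_expKernel_right τ t), ← h6]
              gcongr
              exact lintegral_expKernel_le hτ t _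
          _ = _ := lintegral_const_mul'' _ hqm
      have hAm : AEMeasurable (fun x => ∫⁻ t in Icc 0 Real.pi, expKernel τ x t * ‖F t‖ₑ)
          (volume.restrict (Icc 0 Real.pi)) :=
        ((measurable_expKernel τ).aemeasurable.mul hFm.comp_snd).lintegral_prod_right'
      have hBm : AEMeasurable (fun x => ∫⁻ t in Icc 0 Real.pi, expKernel τ x t * q t)
          (volume.restrict (Icc 0 Real.pi)) :=
        ((measurable_expKernel τ).aemeasurable.mul hqm.comp_snd).lintegral_prod_right'
      have hsq : ∀ a b : ℝ≥0∞, (a + b) ^ 2 ≤ 2 * a ^ 2 + 2 * b ^ 2 := fun a b => by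
        have := ENNReal.rpow_add_le_mul_rpow_add_rpow a b (one_le_two (α := ℝ))
        norm_num at this
        rwa [mul_add] at this
      calc ∫⁻ x in Icc 0 Real.pi, ‖y x‖ₑ ^ 2
          ≤ ∫⁻ x in Icc 0 Real.pi,
              (2 * C₁ ^ 2 * (∫⁻ t in Icc 0 Real.pi, expKernel τ x t * ‖F t‖ₑ) ^ 2 +
              2 * C₁ ^ 2 * Y ^ 2 * (∫⁻ t in Icc 0 Real.pi, expKernel τ x t * q t) ^ 2) := by
            refine setLIntegral_mono' measurableSet_Icc fun x hx => ?_
            refine (pow_le_pow_left' (hpt x hx) 2).trans ?_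
            rw [mul_pow]
            refine (mul_le_mul_right (hsq _ _) _).trans (le_of_eq ?_)
            ring
        _ ≤ 2 * C₁ ^ 2 * ((6 * u) * (6 * u) * n) +
            2 * C₁ ^ 2 * (72 * C₁ ^ 2 * u * n) * ((6 * u) * q₁) := by
            rw [lintegral_add_left' ((hAm.pow_const 2).const_mul _),
              lintegral_const_mul'' _ (hAm.pow_const 2), lintegral_const_mul'' _ (hBm.pow_const 2)]
            gcongr
        _ = (72 * C₁ ^ 2 + 864 * C₁ ^ 4 * q₁) * u ^ 2 * n := by ring

end Perturbation

end Dirac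

end

noncomputable section

namespace Dirac

/-! ### The resolvent in `L₂` and its compactness -/

section Resolvent

open scoped ENNReal BoundedContinuousFunction

variable {Q : ℝ → Matrix (Fin 2) (Fin 2) ℂ} {U : Matrix (Fin 2) (Fin 4) ℂ}

theorem enorm_sq_eq_lintegral (f : Space) :
    ‖f‖ₑ ^ 2 = ∫⁻ t in Icc 0 Real.pi, ‖f t‖ₑ ^ 2 := by
  rw [Lp.enorm_def, eLpNorm_eq_lintegral_rpow_enorm_toReal (by norm_num) (by norm_num),
    ← ENNReal.rpow_two, ← ENNReal.rpow_mul]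
  norm_num

/-- With its converse `IsSolution.exists_represents`, this passes between classes in `L₂` and
solutions of the differential equation, the potential being moved to the right-hand side. -/
theorem Represents.isSolution (z : ℂ) {y : ℝ → EuclideanSpace ℂ (Fin 2)} {f g : Space}
    (H : Represents Q U y f g) :
    IsSolution U z (fun t => (g - z • f : Space) t - (Q t).toEuclideanLin (y t)) y where
  ac := H.ac
  bc := H.bc
  deriv := by
    refine (ae_restrict_iff' measurableSet_Icc).1 ?_
    filter_upwards [H.diff, H.fst, H.snd, Lp.coeFn_sub g (z • f), Lp.coeFn_smul z f]
      with x d e₁ e₂ e₃ e₄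
    refine d.hasDerivAt.congr_deriv ?_
    rw [e₃, Pi.sub_apply, e₄, Pi.smul_apply, e₁, e₂]
    ext i
    fin_cases i <;> simp [diffExpr, toEuclideanLin_apply_fin_two, matB] <;> ring

theorem IsSolution.exists_represents {z : ℂ} {y : ℝ → EuclideanSpace ℂ (Fin 2)} {F : Space}
    (H : IsSolution U z (fun t => F t - (Q t).toEuclideanLin (y t)) y) :
    ∃ f g : Space, Represents Q U y f g ∧ g - z • f = F := by
  have hyc := H.continuousOn
  obtain ⟨M, hM⟩ := isCompact_Icc.exists_bound_of_continuousOn hyc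
  have hy : MemLp y 2 (volume.restrict (Icc 0 Real.pi)) :=
    MemLp.of_bound (hyc.aestronglyMeasurable measurableSet_Icc) M
      ((ae_restrict_iff' measurableSet_Icc).2 (Filter.Eventually.of_forall hM))
  have hd := (ae_restrict_iff' (μ := volume) measurableSet_Icc).2 H.deriv
  refine ⟨hy.toLp y, F + z • hy.toLp y, ⟨H.ac, H.bc, ?_, hy.coeFn_toLp, ?_⟩, add_sub_cancel_right _ _⟩
  · filter_upwards [hd] with x d using d.differentiableAt
  · filter_upwards [hd, hy.coeFn_toLp, Lp.coeFn_add F (z • hy.toLp y),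
      Lp.coeFn_smul z (hy.toLp y)] with x d e₁ e₂ e₃
    rw [e₂, Pi.add_apply, e₃, Pi.smul_apply, e₁, diffExpr, d.deriv]
    ext i
    fin_cases i <;> simp [toEuclideanLin_apply_fin_two, matB] <;> ring

theorem exists_represents (y : (operator Q U).domain) :
    ∃ v, Represents Q U v (y : Space) (operator Q U y) := by
  have h := (operator Q U).mem_graph y
  rwa [operator_graph] at h

/-- The inclusion of the continuous functions on `[0,π]` into `L₂`. -/
def continuousToSpace (v : Icc (0 : ℝ) Real.pi →ᵇ EuclideanSpace ℂ (Fin 2)) : Space :=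
  MemLp.toLp (fun t => v (projIcc 0 Real.pi Real.pi_pos.le t))
    (MemLp.of_bound (v.continuous.comp continuous_projIcc).aestronglyMeasurable ‖v‖
      (Filter.Eventually.of_forall fun _ => v.norm_coe_le_norm _))

theorem coeFn_continuousToSpace (v : Icc (0 : ℝ) Real.pi →ᵇ EuclideanSpace ℂ (Fin 2)) :
    continuousToSpace v =ᵐ[volume.restrict (Icc 0 Real.pi)]
      fun t => v (projIcc 0 Real.pi Real.pi_pos.le t) :=
  MemLp.coeFn_toLp _

theorem continuous_continuousToSpace : Continuous continuousToSpace := by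
  refine (LipschitzWith.of_dist_le_mul
    (K := measureUnivNNReal (volume.restrict (Icc 0 Real.pi)) ^ (2 : ℝ≥0∞).toReal⁻¹)
    fun v w => ?_).continuous
  rw [dist_eq_norm]
  refine Lp.norm_le_of_ae_bound dist_nonneg ?_
  filter_upwards [Lp.coeFn_sub (continuousToSpace v) (continuousToSpace w),
    coeFn_continuousToSpace v, coeFn_continuousToSpace w] with t e₁ e₂ e₃
  rw [e₁, Pi.sub_apply, e₂, e₃, ← dist_eq_norm]
  exact BoundedContinuousFunction.dist_coe_le_dist _

/-- The modulus of continuity of a solution. -/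
theorem IsSolution.edist_le {z : ℂ} {y h : ℝ → EuclideanSpace ℂ (Fin 2)}
    (H : IsSolution U z h y) (hh : IntegrableOn h (Icc 0 Real.pi)) {a b : ℝ}
    (ha : a ∈ Icc 0 Real.pi) (hb : b ∈ Icc 0 Real.pi) :
    edist (y a) (y b) ≤ ∫⁻ t in uIoc a b, 2 * (‖z‖ₑ * ‖y t‖ₑ + ‖h t‖ₑ) := by
  have hpi := Real.pi_pos
  have hu : uIcc 0 Real.pi = Icc 0 Real.pi := uIcc_of_le hpi.le
  have hyi : IntegrableOn y (Icc 0 Real.pi) := H.continuousOn.integrableOn_Icc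
  have hc : ∀ w : ℝ → EuclideanSpace ℂ (Fin 2), IntegrableOn w (Icc 0 Real.pi) → ∀ i,
      IntegrableOn (fun t => w t i) (Icc 0 Real.pi) := fun w hw i =>
    (coordCLM i).integrable_comp hw
  have hd : IntegrableOn (fun t => (!₂[z * y t 1 + h t 1, -(z * y t 0 + h t 0)] :
      EuclideanSpace ℂ (Fin 2))) (Icc 0 Real.pi) := by
    refine Integrable.of_eval_piLp fun i => ?_
    fin_cases i
    · exact ((hc y hyi 1).const_mul z).add (hc h hh 1)
    · exact (((hc y hyi 0).const_mul z).add (hc h hh 0)).neg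
  have e := eq_add_integral_of_ae_hasDerivAt H.ac
    ((intervalIntegrable_iff_integrableOn_Icc_of_le hpi.le).2 hd) (by rw [hu]; exact H.deriv)
    (hu ▸ ha) (hu ▸ hb)
  rw [edist_comm, edist_eq_enorm_sub, e, add_sub_cancel_left]
  calc _ = ‖∫ t in uIoc a b, (!₂[z * y t 1 + h t 1, -(z * y t 0 + h t 0)] :
          EuclideanSpace ℂ (Fin 2))‖ₑ := by
        rw [← ofReal_norm, ← ofReal_norm, intervalIntegral.norm_intervalIntegral_eq]
    _ ≤ ∫⁻ t in uIoc a b, ‖(!₂[z * y t 1 + h t 1, -(z * y t 0 + h t 0)] :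
          EuclideanSpace ℂ (Fin 2))‖ₑ := enorm_integral_le_lintegral_enorm _
    _ ≤ _ := by
        refine lintegral_mono fun t => ?_
        refine (enorm_le_add _).trans ?_
        have m : ∀ i, ‖z * y t i + h t i‖ₑ ≤ ‖z‖ₑ * ‖y t‖ₑ + ‖h t‖ₑ := fun i => by
          refine (enorm_add_le _ _).trans ?_
          rw [enorm_mul]
          gcongr <;> exact enorm_apply_le _ _
        rw [two_mul]
        refine add_le_add (m 1) ?_
        simp only [Matrix.cons_val_one, Matrix.cons_val_fin_one, enorm_neg]
        exact m 0

/-- Solutions with bounded data form a relatively compact set of continuous functions. -/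
theorem isCompact_closure_solutions
    (hQ : ∀ i j, IntegrableOn (fun x => Q x i j) (Icc (0 : ℝ) Real.pi) volume) (z : ℂ) {M : ℝ}
    (hM₀ : 0 ≤ M) :
    IsCompact (closure {v : Icc (0 : ℝ) Real.pi →ᵇ EuclideanSpace ℂ (Fin 2) |
      ∃ (F : Space) (y : ℝ → EuclideanSpace ℂ (Fin 2)), ‖F‖ₑ ≤ 1 ∧ (∀ x, v x = y x) ∧
        (∀ x ∈ Icc 0 Real.pi, ‖y x‖ₑ ≤ ENNReal.ofReal M) ∧
        IsSolution U z (fun t => F t - (Q t).toEuclideanLin (y t)) y}) := by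
  refine BoundedContinuousFunction.arzela_ascoli (Metric.closedBall 0 M)
    (isCompact_closedBall _ _) _ ?_ ?_
  · rintro v x ⟨F, y, -, hv, hM, -⟩
    rw [mem_closedBall_zero_iff, hv]
    have := hM x x.2
    rwa [← ofReal_norm, ENNReal.ofReal_le_ofReal_iff hM₀] at this
  · intro x₀ V hV
    obtain ⟨ε, hε, hεV⟩ := mem_uniformity_edist.1 hV
    set μ := volume.restrict (Icc (0 : ℝ) Real.pi)
    set m : ℝ≥0∞ := ENNReal.ofReal M
    -- An integrable majorant, common to all solutions in the set, for the part of `‖y'‖` that does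
    -- not involve `F`.
    set p : ℝ → ℝ≥0∞ := fun t => 2 * (‖z‖ₑ * m + potentialNorm Q t * m)
    have hpm : AEMeasurable p μ :=
      (aemeasurable_const.add ((aemeasurable_potentialNorm hQ).mul_const _)).const_mul _
    have hpf : ∫⁻ t, p t ∂μ ≠ ∞ := by
      rw [lintegral_const_mul' _ _ (by norm_num), lintegral_add_left' aemeasurable_const,
        lintegral_const, lintegral_mul_const'' _ (aemeasurable_potentialNorm hQ)]
      have := lintegral_potentialNorm_ne_top hQ
      finiteness
    have hvol : Filter.Tendsto (fun x : Icc (0 : ℝ) Real.pi => μ (uIoc (x₀ : ℝ) x)) (nhds x₀)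
        (nhds 0) := by
      have h1 : Filter.Tendsto (fun x : Icc (0 : ℝ) Real.pi => ENNReal.ofReal |(x : ℝ) - x₀|)
          (nhds x₀) (nhds 0) := by
        have : Continuous fun x : Icc (0 : ℝ) Real.pi => ENNReal.ofReal |(x : ℝ) - x₀| :=
          ENNReal.continuous_ofReal.comp (by fun_prop)
        simpa using this.tendsto x₀
      refine tendsto_of_tendsto_of_tendsto_of_le_of_le tendsto_const_nhds h1
        (fun _ => zero_le) fun x => ?_
      refine (Measure.restrict_apply_le _ _).trans ?_
      rw [Real.volume_uIoc]
    -- A common modulus of continuity at `x₀`: absolute continuity of the integral for `p`, and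
    -- Cauchy–Schwarz with `‖F‖ ≤ 1` for the remaining part.
    have hlim : Filter.Tendsto (fun x : Icc (0 : ℝ) Real.pi =>
        (∫⁻ t in uIoc (x₀ : ℝ) x, p t ∂μ) + 2 * (μ (uIoc (x₀ : ℝ) x)) ^ (1 / 2 : ℝ)) (nhds x₀)
        (nhds 0) := by
      have h1 := tendsto_setLIntegral_zero hpf hvol
      have h2 := ENNReal.Tendsto.const_mul (a := 2) (hvol.ennrpow_const (1 / 2 : ℝ))
        (Or.inr (by norm_num))
      have h3 := h1.add h2
      simpa using h3
    filter_upwards [hlim.eventually_lt_const hε] with x hx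
    rintro ⟨v, F, y, hF, hv, hM, hy⟩
    refine hεV (lt_of_le_of_lt ?_ hx)
    have hsub : uIoc (x₀ : ℝ) x ⊆ Icc 0 Real.pi :=
      uIoc_subset_uIcc.trans (uIcc_subset_Icc x₀.2 x.2)
    have hFi : IntegrableOn F (Icc 0 Real.pi) := (Lp.memLp F).integrable (by norm_num)
    have hFm : AEMeasurable (fun t => ‖F t‖ₑ) μ := (Lp.memLp F).1.enorm
    have hμ : μ.restrict (uIoc (x₀ : ℝ) x) = volume.restrict (uIoc (x₀ : ℝ) x) :=
      Measure.restrict_restrict_of_subset hsub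
    change edist (v x₀) (v x) ≤ _
    rw [hv, hv]
    refine (hy.edist_le (hFi.sub (integrableOn_toEuclideanLin hQ hy.continuousOn)) x₀.2
      x.2).trans ?_
    have hcs : ∫⁻ t in uIoc (x₀ : ℝ) x, ‖F t‖ₑ ∂μ ≤ (μ (uIoc (x₀ : ℝ) x)) ^ (1 / 2 : ℝ) := by
      refine (ENNReal.pow_le_pow_left_iff two_ne_zero).1 ?_
      have h1 := sq_lintegral_mul_le (μ := μ.restrict (uIoc (x₀ : ℝ) x)) (f := fun t => ‖F t‖ₑ)
        (g := fun _ => 1) hFm.restrict aemeasurable_const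
      simp only [mul_one, one_pow, lintegral_one, Measure.restrict_apply_univ] at h1
      refine h1.trans ?_
      rw [← ENNReal.rpow_two (_ ^ (1 / 2 : ℝ)), ← ENNReal.rpow_mul]
      norm_num
      refine mul_le_of_le_one_left' ?_
      calc ∫⁻ t in uIoc (x₀ : ℝ) x, ‖F t‖ₑ ^ 2 ∂μ ≤ ∫⁻ t, ‖F t‖ₑ ^ 2 ∂μ :=
            setLIntegral_le_lintegral _ _
        _ = ‖F‖ₑ ^ 2 := (enorm_sq_eq_lintegral F).symm
        _ ≤ 1 := pow_le_one' hF 2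
    calc _ ≤ ∫⁻ t in uIoc (x₀ : ℝ) x, (p t + 2 * ‖F t‖ₑ) := by
          refine setLIntegral_mono' measurableSet_uIoc fun t ht => ?_
          have h1 : ‖F t - (Q t).toEuclideanLin (y t)‖ₑ ≤ ‖F t‖ₑ + potentialNorm Q t * m := by
            refine enorm_sub_le.trans ?_
            gcongr
            refine (enorm_toEuclideanLin_le Q t _).trans ?_
            gcongr
            exact hM t (hsub ht)
          calc 2 * (‖z‖ₑ * ‖y t‖ₑ + ‖F t - (Q t).toEuclideanLin (y t)‖ₑ)
              ≤ 2 * (‖z‖ₑ * m + (‖F t‖ₑ + potentialNorm Q t * m)) := by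
                gcongr
                exact hM t (hsub ht)
            _ = _ := by simp only [p]; ring
      _ = ∫⁻ t in uIoc (x₀ : ℝ) x, (p t + 2 * ‖F t‖ₑ) ∂μ := by rw [hμ]
      _ = (∫⁻ t in uIoc (x₀ : ℝ) x, p t ∂μ) + 2 * ∫⁻ t in uIoc (x₀ : ℝ) x, ‖F t‖ₑ ∂μ := by
          rw [lintegral_add_left' hpm.restrict,
            lintegral_const_mul' _ (fun t => ‖F t‖ₑ) (by norm_num)]
      _ ≤ _ := by gcongr

/-- The `L₂` bound of `exists_solution_bound` yields the norm estimate, and the uniform bound yields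
compactness: the image of the unit ball lies in the image in `L₂` of a compact set of continuous
functions. -/
theorem exists_resolvent_bound (hU : IsRegular U)
    (hQ : ∀ i j, IntegrableOn (fun x => Q x i j) (Icc (0 : ℝ) Real.pi) volume) :
    ∃ C : ℝ, ∃ τ₀ > 0, ∀ z : ℂ, τ₀ ≤ |z.im| → ∃ R : Space →L[ℂ] Space,
      IsResolventAt (operator Q U) z R ∧ ‖R‖ ≤ C * |z.im|⁻¹ ∧ IsCompactOperator R := by
  obtain ⟨C, hC, τ₀, hτ₀, H⟩ := exists_solution_bound hU hQ
  refine ⟨(C ^ (1 / 2 : ℝ)).toReal, τ₀, hτ₀, fun z hz => ?_⟩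
  have hτ : 0 < |z.im| := lt_of_lt_of_le hτ₀ hz
  have hsurj : ∀ F : Space, ∃ y : (operator Q U).domain, operator Q U y - z • (y : Space) = F := by
    intro F
    obtain ⟨y, hy⟩ := (H z hz F (Lp.memLp F)).1
    obtain ⟨f, g, hfg, e⟩ := hy.exists_represents
    have hmem : (f, g) ∈ (operator Q U).graph := by
      rw [operator_graph]
      exact ⟨y, hfg⟩
    obtain ⟨u, hu1, hu2⟩ := (LinearPMap.mem_graph_iff _).1 hmem
    exact ⟨u, by rw [hu1, hu2]; exact e⟩
  have hbound : ∀ y : (operator Q U).domain, ‖(y : Space)‖ ≤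
      (C ^ (1 / 2 : ℝ)).toReal * |z.im|⁻¹ * ‖operator Q U y - z • (y : Space)‖ := by
    intro y
    obtain ⟨v, hv⟩ := exists_represents y
    set F : Space := operator Q U y - z • (y : Space)
    have h1 := ((H z hz F (Lp.memLp F)).2 v (hv.isSolution z)).2
    have h2 : ‖(y : Space)‖ₑ ^ 2 = ∫⁻ x in Icc 0 Real.pi, ‖v x‖ₑ ^ 2 := by
      rw [enorm_sq_eq_lintegral]
      refine lintegral_congr_ae ?_
      filter_upwards [hv.fst] with x e
      rw [e]
    have hK : C = (C ^ (1 / 2 : ℝ)) ^ 2 := by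
      rw [← ENNReal.rpow_two, ← ENNReal.rpow_mul]
      norm_num
    rw [← h2, ← enorm_sq_eq_lintegral, hK, ← mul_pow, ← mul_pow,
      ENNReal.pow_le_pow_left_iff two_ne_zero] at h1
    have h3 := ENNReal.toReal_mono (by finiteness) h1
    rwa [ENNReal.toReal_mul, ENNReal.toReal_mul, ENNReal.toReal_ofReal (by positivity),
      toReal_enorm, toReal_enorm] at h3
  obtain ⟨R, hR, hRn⟩ := exists_isResolventAt (operator Q U) z (by positivity) hsurj hbound
  refine ⟨R, hR, hRn, ?_⟩
  -- The uniform bound of the solutions with `‖F‖ ≤ 1`.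
  set M : ℝ≥0∞ := (C * ENNReal.ofReal |z.im|⁻¹) ^ (1 / 2 : ℝ)
  refine ⟨_, (isCompact_closure_solutions (U := U) hQ z (ENNReal.toReal_nonneg (a := M))).image continuous_continuousToSpace,
    Filter.mem_of_superset (Metric.closedBall_mem_nhds (0 : Space) one_pos) fun F hF => ?_⟩
  obtain ⟨hd, e⟩ := hR.1 F
  obtain ⟨v, hv⟩ := exists_represents ⟨R F, hd⟩
  have hs := hv.isSolution z
  rw [e] at hs
  have hF1 : ‖F‖ₑ ≤ 1 := by
    rw [← ofReal_norm, ENNReal.ofReal_le_one]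
    simpa using hF
  let w : Icc (0 : ℝ) Real.pi →ᵇ EuclideanSpace ℂ (Fin 2) :=
    BoundedContinuousFunction.mkOfCompact ⟨fun x => v x,
      hs.continuousOn.comp_continuous continuous_subtype_val fun x => x.2⟩
  refine ⟨w, subset_closure ⟨F, v, hF1, fun _ => rfl, fun x hx => ?_, hs⟩, ?_⟩
  · have h1 := ((H z hz F (Lp.memLp F)).2 v hs).1 x hx
    refine (ENNReal.pow_le_pow_left_iff two_ne_zero).1 ?_
    rw [ENNReal.ofReal_toReal (by finiteness), ← ENNReal.rpow_two (_ ^ (1 / 2 : ℝ)),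
      ← ENNReal.rpow_mul]
    norm_num
    refine h1.trans (mul_le_of_le_one_right' ?_)
    rw [← enorm_sq_eq_lintegral]
    exact pow_le_one' hF1 2
  · refine Lp.ext ?_
    filter_upwards [coeFn_continuousToSpace w, hv.fst, ae_restrict_mem measurableSet_Icc]
      with t e₁ e₂ ht
    rw [e₁, e₂, projIcc_of_mem _ ht]
    rfl

end Resolvent

end Dirac

theorem theorem4p1 (Q : ℝ → Matrix (Fin 2) (Fin 2) ℂ) (U : Matrix (Fin 2) (Fin 4) ℂ)
    (hU : Dirac.IsStronglyRegular U)
    (hQ : ∀ i j, IntegrableOn (fun x => Q x i j) (Icc (0 : ℝ) Real.pi) volume) :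
    (∃ α : ℝ, 1 < α ∧ ∃ C : ℝ, ∀ z : ℂ, α < |z.im| →
      ∃ R : Dirac.Space →L[ℂ] Dirac.Space,
        Dirac.IsResolventAt (Dirac.operator Q U) z R ∧ ‖R‖ ≤ C * |z.im|⁻¹) ∧
    Dirac.HasDiscreteSpectrum (Dirac.operator Q U) := by
  obtain ⟨C, τ₀, hτ₀, H⟩ := Dirac.exists_resolvent_bound hU.1 hQ
  refine ⟨⟨τ₀ + 1, by linarith, C, fun z hz => ?_⟩, ?_⟩
  · obtain ⟨R, hR, hn, -⟩ := H z (by linarith)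
    exact ⟨R, hR, hn⟩
  -- One compact resolvent suffices for discreteness.
  · obtain ⟨R, hR, -, hc⟩ := H (τ₀ * Complex.I) (by simpa using le_abs_self τ₀)
    exact hR.hasDiscreteSpectrum hc
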